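/- **Definitions.** For a polynomial $g:\mathbf C^m\to\mathbf C$ let $\operatorname{grad} g(x)=\bigl(\overline{\partial g/\partial x_1(x)},\dots,\overline{\partial g/\partial x_m(x)}\bigr)$, let $\langle z,w\rangle=\sum_i z_i\overline{w_i}$ and let $\|\cdot\|$ be the associated norm. Put $M(g)=\{x\in\mathbf C^m : \exists \lambda\in\mathbf C,\ \operatorname{grad} g(x)=\lambda x\}$. - $g$ is *M-tame* if $|g(z^k)|\to\infty$ for every sequence $(z^k)$ in $M(g)$ with $\|z^k\|\to\infty$. - $g$ is *quasitame* if $|g(z^k)-\langle z^k,\operatorname{grad} g(z^k)\rangle|\to\infty$ for every sequence $(z^k)$ in $\mathbf C^m$ with $\|z^k\|\to\infty$ and $\operatorname{grad} g(z^k)\to 0$. - $g$ satisfies *Malgrange's condition* at $t_0\in\mathbf C$ if there are $\delta>0$, $R\in\mathbf R$ and $\varepsilon>0$ such that $\|x\|\cdot\|\operatorname{grad} g(x)\|\ge\delta$ for all $x\in\mathbf C^m$ with $\|x\|\ge R$ and $|g(x)-t_0|<\varepsilon$. For integers $n,q\ge 1$ let $f_{n,q}:\mathbf C^3\to\mathbf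 C$, $f_{n,q}(x,y,z)=x-3x^{2n+1}y^{2q}+2x^{3n+1}y^{3q}+yz$. **Proposition.** (a) For all integers $n,q\ge1$, the polynomial $f_{n,q}$ is M-tame but not quasitame. (b) For all integers $n,q\ge1$, the polynomial $f_{n,q}$ satisfies Malgrange's condition at every $t_0\in\mathbf C$ if and only if $n\le q$. (c) For every $m\ge3$, both of the implications "quasitame $\Rightarrow$ Malgrange's condition at every $t_0\in\mathbf C$ $\Rightarrow$ M-tame" hold for all polynomials $g:\mathbf C^m\to\mathbf C$, and neither can be reversed: some polynomial $g:\mathbf C^m\to\mathbf C$ satisfies Malgrange's condition at every $t_0\in\mathbf C$ without being quasitame, and some polynomial $g:\mathbf C^m\to\mathbf C$ is M-tame but fails Malgrange's condition at some $t_0\in\mathbf C$. -/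

import Mathlib

open Filter Topology

namespace PolyInfinity

noncomputable section

/-- The value `g(x)` of a complex polynomial in `m` variables at a point of `ℂ^m`
(with its Hermitian norm). -/
def val {m : ℕ} (g : MvPolynomial (Fin m) ℂ) (x : EuclideanSpace ℂ (Fin m)) : ℂ :=
  MvPolynomial.eval (fun i => x i) g

/-- The gradient: the vector of complex conjugates of the partial derivatives of `g` at `x`. -/
def grad {m : ℕ} (g : MvPolynomial (Fin m) ℂ) (x : EuclideanSpace ℂ (Fin m)) :
    EuclideanSpace ℂ (Fin m) :=
  WithLp.toLp 2 (fun i =>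
    (starRingEnd ℂ) (MvPolynomial.eval (fun j => x j) (MvPolynomial.pderiv i g)))

/-- The set `M(g)` of points at which the gradient is a complex multiple of the point. -/
def milnorSet {m : ℕ} (g : MvPolynomial (Fin m) ℂ) : Set (EuclideanSpace ℂ (Fin m)) :=
  {x | ∃ c : ℂ, grad g x = c • x}

/-- `g` is M-tame: `|g|` tends to infinity along every sequence in `M(g)` whose norm tends to
infinity. -/
def MTame {m : ℕ} (g : MvPolynomial (Fin m) ℂ) : Prop :=
  ∀ z : ℕ → EuclideanSpace ℂ (Fin m), (∀ k, z k ∈ milnorSet g) →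
    Tendsto (fun k => ‖z k‖) atTop atTop →
    Tendsto (fun k => ‖val g (z k)‖) atTop atTop

/-- `g` is quasitame. The Hermitian product `⟨z, w⟩ = ∑ i, z i * conj (w i)`, linear
in its first argument, is `inner ℂ w z` in Mathlib, so `inner ℂ (grad g z) z` is
`∑ i, z i * (∂g/∂z_i)(z)`. -/
def Quasitame {m : ℕ} (g : MvPolynomial (Fin m) ℂ) : Prop :=
  ∀ z : ℕ → EuclideanSpace ℂ (Fin m),
    Tendsto (fun k => ‖z k‖) atTop atTop →
    Tendsto (fun k => grad g (z k)) atTop (𝓝 0) →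
    Tendsto (fun k => ‖val g (z k) - inner ℂ (grad g (z k)) (z k)‖) atTop atTop

/-- Malgrange's condition for `t₀`: `‖x‖ * ‖grad g x‖` is bounded below by a positive constant
for `‖x‖` large enough and `g x` close enough to `t₀`. -/
def Malgrange {m : ℕ} (g : MvPolynomial (Fin m) ℂ) (t₀ : ℂ) : Prop :=
  ∃ δ > (0 : ℝ), ∃ R : ℝ, ∃ ε > (0 : ℝ), ∀ x : EuclideanSpace ℂ (Fin m),
    R ≤ ‖x‖ → ‖val g x - t₀‖ < ε → δ ≤ ‖x‖ * ‖grad g x‖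

/-- `f_{n,q}(x,y,z) = x - 3 x^(2n+1) y^(2q) + 2 x^(3n+1) y^(3q) + y z`. -/
def fPoly (n q : ℕ) : MvPolynomial (Fin 3) ℂ :=
  MvPolynomial.X 0
    - 3 * MvPolynomial.X 0 ^ (2 * n + 1) * MvPolynomial.X 1 ^ (2 * q)
    + 2 * MvPolynomial.X 0 ^ (3 * n + 1) * MvPolynomial.X 1 ^ (3 * q)
    + MvPolynomial.X 1 * MvPolynomial.X 2

end

end PolyInfinity

namespace PolyInfinity

section DerivationOnCurve

open Polynomial

/-- On a finite extension of the field of rational functions there is a derivation extending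
`X d/dX`. -/
theorem exists_derivation_map_eq_self (k F K : Type*) [Field k] [CharZero k] [Field F] [Field K]
    [Algebra k[X] F] [IsFractionRing k[X] F] [Algebra k K] [Algebra k[X] K] [Algebra F K]
    [IsScalarTower k[X] F K] [IsScalarTower k k[X] K] [FiniteDimensional F K] :
    ∃ D : Derivation k K K, D (algebraMap k[X] K X) = algebraMap k[X] K X := by
  have : CharZero F :=
    charZero_of_injective_algebraMap (IsFractionRing.injective k[X] F)
  have : Algebra.FormallyEtale k[X] F :=
    Algebra.FormallyEtale.of_isLocalization (nonZeroDivisors k[X])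
  have : Algebra.FormallyEtale F K := Algebra.FormallyEtale.of_isSeparable F K
  have : Algebra.FormallyEtale k[X] K := Algebra.FormallyEtale.comp k[X] F K
  let D₀ : Derivation k k[X] K := mkDerivation k (algebraMap k[X] K X)
  let φ : TensorProduct k[X] K (Ω[k[X]⁄k]) →ₗ[K] K := D₀.liftKaehlerDifferential.liftBaseChange K
  let e := (KaehlerDifferential.tensorKaehlerEquivOfFormallyEtale k k[X] K).symm
  refine ⟨(φ.comp e.toLinearMap).compDer (KaehlerDifferential.D k K), ?_⟩
  have : e (KaehlerDifferential.D k K (algebraMap k[X] K X)) = _ :=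
    KaehlerDifferential.tensorKaehlerEquivOfFormallyEtale_symm_D_algebraMap k k[X] K X
  simp [this, φ, D₀, mkDerivation_X]

/-- An element of a valuation subring containing a Dedekind domain `A` with fraction field `K` is
a fraction whose denominator is a unit of the valuation subring. -/
theorem exists_mul_eq_of_mem_valuationSubring {A K : Type*} [CommRing A] [IsDedekindDomain A]
    [Field K] [Algebra A K] [IsFractionRing A K] (O : ValuationSubring K)
    (hA : ∀ a : A, algebraMap A K a ∈ O) {p : A} (hp : p ≠ 0)
    (hpv : O.valuation (algebraMap A K p) < 1) {r : K} (hr : r ∈ O) :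
    ∃ s t : A, O.valuation (algebraMap A K t) = 1 ∧ r * algebraMap A K t = algebraMap A K s := by
  let f : A →+* O := (algebraMap A K).codRestrict O.toSubring hA
  let P : Ideal A := (IsLocalRing.maximalIdeal O).comap f
  have memP : ∀ a : A, a ∈ P ↔ O.valuation (algebraMap A K a) < 1 := fun a =>
    O.valuation_lt_one_iff (f a)
  have one_of : ∀ a : A, a ∉ P → O.valuation (algebraMap A K a) = 1 := fun a ha =>
    le_antisymm ((O.valuation_le_one_iff _).2 (hA a)) (not_lt.1 fun h => ha ((memP a).2 h))
  have hP : P ≠ ⊥ := fun h => hp (by simpa [h] using (memP p).2 hpv)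
  have : P.IsPrime := Ideal.IsPrime.comap f
  have : IsDiscreteValuationRing (Localization.AtPrime P) :=
    IsLocalization.AtPrime.isDiscreteValuationRing_of_dedekind_domain A hP _
  have inj : Function.Injective (algebraMap A (Localization.AtPrime P)) :=
    IsLocalization.injective _ P.primeCompl_le_nonZeroDivisors
  obtain ⟨a, b, hb, rfl⟩ := IsFractionRing.div_surjective (A := A) r
  have hb0 : b ≠ 0 := nonZeroDivisors.ne_zero hb
  have hbK : algebraMap A K b ≠ 0 := by simpa using hb0
  obtain ⟨c, hc⟩ := ValuationRing.cond (algebraMap A (Localization.AtPrime P) a)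
    (algebraMap A (Localization.AtPrime P) b)
  obtain ⟨⟨s, t⟩, hst⟩ := IsLocalization.surj P.primeCompl c
  have ht : (t : A) ∉ P := t.2
  rcases hc with hc | hc
  · have h1 : a * s = b * t := inj (by rw [map_mul, map_mul, ← hst, ← hc]; ring)
    have h2 : algebraMap A K a / algebraMap A K b * algebraMap A K s = algebraMap A K t := by
      rw [div_mul_eq_mul_div, div_eq_iff hbK, ← map_mul, h1, ← map_mul, mul_comm]
    refine ⟨t, s, one_of s fun hs => ?_, h2⟩
    have h3 := one_of t ht
    rw [← h2, map_mul] at h3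
    exact absurd h3 (ne_of_lt (mul_lt_one_of_nonneg_of_lt_one_right ((O.valuation_le_one_iff _).2 hr)
      zero_le ((memP s).1 hs)))
  · have h1 : b * s = a * t := inj (by rw [map_mul, map_mul, ← hst, ← hc]; ring)
    refine ⟨s, t, one_of t ht, ?_⟩
    rw [div_mul_eq_mul_div, div_eq_iff hbK, ← map_mul, ← h1, map_mul, mul_comm]

theorem isDiscreteValuationRing_valuationSubring {A K : Type*} [CommRing A] [IsDedekindDomain A]
    [Field K] [Algebra A K] [IsFractionRing A K] (O : ValuationSubring K)
    (hA : ∀ a : A, algebraMap A K a ∈ O) {p : A} (hp : p ≠ 0)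
    (hpv : O.valuation (algebraMap A K p) < 1) : IsDiscreteValuationRing O := by
  let f : A →+* O := (algebraMap A K).codRestrict O.toSubring hA
  let : Algebra A O := f.toAlgebra
  let P : Ideal A := (IsLocalRing.maximalIdeal O).comap f
  have memP : ∀ a : A, a ∈ P ↔ O.valuation (algebraMap A K a) < 1 := fun a =>
    O.valuation_lt_one_iff (f a)
  have hP : P ≠ ⊥ := fun h => hp (by simpa [h] using (memP p).2 hpv)
  have : P.IsPrime := Ideal.IsPrime.comap f
  have finj : Function.Injective f := fun a b h =>
    IsFractionRing.injective A K (congrArg Subtype.val h)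
  have isLoc : IsLocalization.AtPrime O P := by
    refine (isLocalization_iff _ _).2 ⟨fun t => ?_, fun z => ?_, fun h => ⟨1, by rw [finj h]⟩⟩
    · by_contra hu
      exact t.2 ((IsLocalRing.mem_maximalIdeal _).2 hu)
    · obtain ⟨s, t, ht, hst⟩ := exists_mul_eq_of_mem_valuationSubring O hA hp hpv z.2
      exact ⟨⟨s, ⟨t, fun h => absurd ht (ne_of_lt ((memP t).1 h))⟩⟩, Subtype.ext hst⟩
  exact IsLocalization.AtPrime.isDiscreteValuationRing_of_dedekind_domain A hP O


/-- Let `D` be a derivation over `k` of a function field of one variable `K` over `k`, and `O` a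
valuation ring of `K` with residue field `k`. If `D y = y` for a transcendental `y` in the maximal
ideal of `O`, then `D` maps `O` into its maximal ideal. -/
theorem valuation_derivation_lt_one (k F K : Type*) [Field k] [CharZero k] [Field F] [Field K]
    [Algebra k[X] F] [IsFractionRing k[X] F] [Algebra k K] [Algebra k[X] K] [Algebra F K]
    [IsScalarTower k[X] F K] [IsScalarTower k k[X] K] [FiniteDimensional F K]
    (D : Derivation k K K) (hD : D (algebraMap k[X] K X) = algebraMap k[X] K X)
    (O : ValuationSubring K) (hk : ∀ c : k, algebraMap k K c ∈ O)
    (hres : ∀ r ∈ O, ∃ c : k, O.valuation (r - algebraMap k K c) < 1)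
    (hy : O.valuation (algebraMap k[X] K X) < 1) {r : K} (hr : r ∈ O) :
    O.valuation (D r) < 1 := by
  have : CharZero F :=
    charZero_of_injective_algebraMap (IsFractionRing.injective k[X] F)
  set y : K := algebraMap k[X] K X with hydef
  set v := O.valuation with hv
  have memO : ∀ x : K, v x ≤ 1 ↔ x ∈ O := O.valuation_le_one_iff
  have hpoly : ∀ f : k[X], algebraMap k[X] K f = aeval y f := fun f => by
    rw [hydef, aeval_algebraMap_apply, aeval_X_left_apply]
  have hyO : y ∈ O := (memO _).1 hy.le
  have hpolyO : ∀ f : k[X], algebraMap k[X] K f ∈ O := fun f => by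
    rw [hpoly, aeval_eq_sum_range]
    refine sum_mem fun i _ => ?_
    rw [Algebra.smul_def]
    exact mul_mem (hk _) (pow_mem hyO _)
  let A := integralClosure k[X] K
  have : IsDedekindDomain A := integralClosure.isDedekindDomain k[X] F K
  have : IsFractionRing A K := integralClosure.isFractionRing_of_finite_extension F K
  have : Module.Finite k[X] A := IsIntegralClosure.finite k[X] F K A
  have hAO : ∀ a : A, algebraMap A K a ∈ O := fun a => by
    obtain ⟨p, hp, hpa⟩ := a.2
    let f : k[X] →+* O := (algebraMap k[X] K).codRestrict O.toSubring hpolyO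
    have hint : IsIntegral O (a : K) := ⟨p.map f, hp.map f, by rw [eval₂_map]; exact hpa⟩
    obtain ⟨z, hz⟩ := IsIntegrallyClosed.isIntegral_iff.1 hint
    have hz' : (z : K) = algebraMap A K a := hz
    rw [← hz']
    exact z.2
  have injX : Function.Injective (algebraMap k[X] K) := by
    rw [IsScalarTower.algebraMap_eq k[X] F K]
    exact (algebraMap F K).injective.comp (IsFractionRing.injective k[X] F)
  have hy0 : y ≠ 0 := fun h => X_ne_zero (injX (h.trans (map_zero _).symm))
  have hyA : algebraMap A K (algebraMap k[X] A X) = y :=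
    (IsScalarTower.algebraMap_apply k[X] A K X).symm
  have hp0 : algebraMap k[X] A X ≠ 0 := fun h => hy0 (by rw [← hyA, h, map_zero])
  have : IsDiscreteValuationRing O :=
    isDiscreteValuationRing_valuationSubring O hAO hp0 (by rw [hyA]; exact hy)
  obtain ⟨τ, hτ⟩ := IsDiscreteValuationRing.exists_irreducible O
  have hτ0 : (τ : K) ≠ 0 := fun h => hτ.ne_zero (Subtype.ext h)
  have hmax : IsLocalRing.maximalIdeal O = Ideal.span {τ} := hτ.maximalIdeal_eq
  have hdiv : ∀ x : K, v x < 1 → ∃ z ∈ O, x = τ * z := fun x hx => by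
    have hxO := (memO x).1 hx.le
    have h1 : (⟨x, hxO⟩ : O) ∈ Ideal.span {τ} := by
      rw [← hmax]; exact (O.valuation_lt_one_iff _).2 hx
    obtain ⟨z, hz⟩ := Ideal.mem_span_singleton'.1 h1
    exact ⟨z, z.2, by rw [mul_comm]; exact (congrArg Subtype.val hz).symm⟩
  have hvτ : v τ < 1 := (O.valuation_lt_one_iff τ).1 (by rw [hmax]; exact Ideal.mem_span_singleton_self τ)
  have hfrac : ∀ x : K, ∃ n : ℕ, v (τ ^ n * x) ≤ 1 := fun x => by
    rcases O.mem_or_inv_mem x with hx | hx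
    · exact ⟨0, by rw [pow_zero, one_mul]; exact (memO x).2 hx⟩
    · rcases eq_or_ne x 0 with rfl | hx0
      · exact ⟨0, by simp⟩
      obtain ⟨n, u, hu⟩ := IsDiscreteValuationRing.eq_unit_mul_pow_irreducible
        (x := (⟨x⁻¹, hx⟩ : O)) (fun h => inv_ne_zero hx0 (congrArg Subtype.val h)) hτ
      have hu' : x⁻¹ = (u : O) * (τ : K) ^ n := congrArg Subtype.val hu
      refine ⟨n, le_of_eq ?_⟩
      have h1 : (u : O) * ((τ : K) ^ n * x) = 1 := by
        rw [← mul_assoc, ← hu', inv_mul_cancel₀ hx0]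
      have h2 := congrArg v h1
      rwa [map_mul, hv, O.valuation_unit u, one_mul, map_one] at h2
  have hbound : ∃ n : ℕ, ∀ a : A, v (τ ^ n * D (algebraMap A K a)) ≤ 1 := by
    obtain ⟨S, hS⟩ := Module.Finite.fg_top (R := k[X]) (M := A)
    choose N hN using fun a : A => hfrac (D (algebraMap A K a))
    refine ⟨S.sup N, fun a => ?_⟩
    have ha : a ∈ Submodule.span k[X] (S : Set A) := by rw [hS]; trivial
    induction ha using Submodule.span_induction with
    | mem a ha =>
      rw [← Nat.sub_add_cancel (Finset.le_sup (f := N) ha), pow_add, mul_assoc, map_mul]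
      exact mul_le_one' ((memO _).2 (pow_mem τ.2 _)) (hN a)
    | zero => simp
    | add a b _ _ iha ihb =>
      rw [map_add, map_add, mul_add]
      exact (v.map_add _ _).trans (max_le iha ihb)
    | smul f a _ ih =>
      have h1 : algebraMap A K (f • a) = algebraMap k[X] K f * algebraMap A K a := by
        rw [Algebra.smul_def, map_mul, ← IsScalarTower.algebraMap_apply]
      have h2 : D (algebraMap k[X] K f) ∈ O := by
        rw [hpoly, D.map_aeval, hD, ← hpoly, smul_eq_mul]
        exact mul_mem (hpolyO _) hyO
      have h3 : τ ^ (S.sup N) * D (algebraMap A K (f • a)) =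
          algebraMap k[X] K f * (τ ^ (S.sup N) * D (algebraMap A K a)) +
            τ ^ (S.sup N) * (algebraMap A K a * D (algebraMap k[X] K f)) := by
        rw [h1, D.leibniz, smul_eq_mul, smul_eq_mul]; ring
      rw [h3]
      refine (v.map_add _ _).trans (max_le ?_ ?_)
      · rw [map_mul]; exact mul_le_one' ((memO _).2 (hpolyO f)) ih
      · exact (memO _).2 (mul_mem (pow_mem τ.2 _) (mul_mem (hAO a) h2))
  obtain ⟨N, hN⟩ := hbound
  have hboundO : ∀ x ∈ O, v (τ ^ N * D x) ≤ 1 := fun x hx => by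
    obtain ⟨s, t, ht, hst⟩ := exists_mul_eq_of_mem_valuationSubring O hAO hp0
      (by rw [hyA]; exact hy) hx
    have h1 := congrArg D hst
    rw [D.leibniz, smul_eq_mul, smul_eq_mul] at h1
    have h2 : algebraMap A K t * (τ ^ N * D x) =
      τ ^ N * D (algebraMap A K s) - x * (τ ^ N * D (algebraMap A K t)) := by
      rw [← h1]; ring
    have h3 := congrArg v h2
    rw [map_mul, hv, ht, one_mul] at h3
    rw [← hv] at h3
    rw [h3]
    refine (v.map_sub _ _).trans (max_le (hN s) ?_)
    rw [map_mul]
    exact mul_le_one' ((memO x).2 hx) (hN t)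
  have hiter : ∀ n : ℕ, ∀ x ∈ O, ∃ a ∈ O, ∃ z ∈ O, D x = a * D τ + τ ^ n * D z := by
    intro n
    induction n with
    | zero => exact fun x hx => ⟨0, zero_mem _, x, hx, by simp⟩
    | succ n ih =>
      intro x hx
      obtain ⟨a, ha, z, hz, h1⟩ := ih x hx
      obtain ⟨c, hc⟩ := hres z hz
      obtain ⟨w, hw, h2⟩ := hdiv _ hc
      refine ⟨a + τ ^ n * w, add_mem ha (mul_mem (pow_mem τ.2 _) hw), w, hw, ?_⟩
      have h3 : D z = τ * D w + w * D τ := by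
        rw [eq_add_of_sub_eq h2, map_add, D.map_algebraMap, add_zero, D.leibniz]; rfl
      rw [h1, h3]; ring
  have hmaxb : ∀ x ∈ O, v (D x) ≤ max (v (D τ)) (v τ) := fun x hx => by
    obtain ⟨a, ha, z, hz, h1⟩ := hiter (N + 1) x hx
    rw [h1]
    refine (v.map_add _ _).trans (max_le_max ?_ ?_)
    · rw [map_mul]; exact mul_le_of_le_one_left' ((memO a).2 ha)
    · rw [pow_succ', mul_assoc, map_mul]
      exact mul_le_of_le_one_right' (hboundO z hz)
  have hDτ : v (D τ) < 1 := by
    obtain ⟨e, u, hu⟩ := IsDiscreteValuationRing.eq_unit_mul_pow_irreducible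
      (x := (⟨y, hyO⟩ : O)) (fun h => hy0 (congrArg Subtype.val h)) hτ
    have hu' : y = (u : O) * (τ : K) ^ e := congrArg Subtype.val hu
    have hvu : v ((u : O) : K) = 1 := (O.valuation_unit u)
    have he : e ≠ 0 := by
      rintro rfl
      rw [pow_zero, mul_one] at hu'
      rw [hu', hvu] at hy
      exact lt_irrefl _ hy
    obtain ⟨e, rfl⟩ := Nat.exists_eq_succ_of_ne_zero he
    have h1 := hD
    rw [hu', D.leibniz, D.leibniz_pow] at h1
    simp only [smul_eq_mul, nsmul_eq_mul, Nat.succ_eq_add_one, Nat.add_sub_cancel] at h1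
    have h2 : ((e + 1 : ℕ) : K) * (u : O) * D τ = τ * ((u : O) - D (u : O)) :=
      mul_left_cancel₀ (pow_ne_zero e hτ0) (by linear_combination h1)
    have hvn : v ((e + 1 : ℕ) : K) = 1 := by
      have h3 : ((e + 1 : ℕ) : k) ≠ 0 := Nat.cast_ne_zero.2 (Nat.succ_ne_zero e)
      have h4 : v (algebraMap k K ((e + 1 : ℕ) : k)) * v (algebraMap k K ((e + 1 : ℕ) : k)⁻¹) = 1 := by
        rw [← map_mul, ← map_mul, mul_inv_cancel₀ h3, map_one, map_one]
      rw [map_natCast] at h4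
      refine le_antisymm ((memO _).2 (natCast_mem O _)) ?_
      rw [← h4]
      exact mul_le_of_le_one_right' ((memO _).2 (hk _))
    have h3 := congrArg v h2
    rw [map_mul, map_mul, hvn, hvu, one_mul, one_mul, map_mul] at h3
    have h4 : v ((u : O) - D (u : O)) ≤ max 1 (v (D τ)) :=
      (v.map_sub _ _).trans (max_le (hvu.le.trans (le_max_left _ _))
        ((hmaxb _ (u : O).2).trans (max_le (le_max_right _ _) (hvτ.le.trans (le_max_left _ _)))))
    by_contra hcon
    rw [max_eq_right (not_lt.1 hcon)] at h4
    have h5 : v (D τ) ≤ v τ * v (D τ) := h3.le.trans (mul_le_mul_right h4 _)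
    have h6 : 0 < v (D τ) := lt_of_lt_of_le zero_lt_one (not_lt.1 hcon)
    exact absurd h5 (not_le.2 (mul_lt_of_lt_one_left h6 hvτ))
  exact (hmaxb r hr).trans_lt (max_lt hDτ hvτ)

end DerivationOnCurve
end PolyInfinity

namespace PolyInfinity

section Specialization

open Polynomial

/-- Finitely many elements `x i` algebraic over a domain `R` of characteristic zero are, after
inverting one element `d`, polynomials in one simple root `θ` of a polynomial `P`; so for
every homomorphism `φ` from `R` to a field that does not kill `d`, a root of `φ P` yields a
specialization of the `x i` along `φ`. -/
theorem exists_specialization_of_isAlgebraic {R Ω ι : Type*} [CommRing R] [IsDomain R] [Field Ω]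
    [CharZero Ω] [Algebra R Ω] [FaithfulSMul R Ω] [Finite ι] (x : ι → Ω)
    (hx : ∀ i, IsAlgebraic R (x i)) :
    ∃ d : R, d ≠ 0 ∧ ∃ (P : R[X]) (θ : Ω), aeval θ P = 0 ∧ aeval θ (derivative P) ≠ 0 ∧
      ∀ φ : R →+* Ω, φ d ≠ 0 → ∀ θ' : Ω, P.eval₂ φ θ' = 0 →
        ∃ x' : ι → Ω, ∀ Q : MvPolynomial ι R,
          MvPolynomial.aeval x Q = 0 → MvPolynomial.eval₂ φ x' Q = 0 := by
  classical
  have := Fintype.ofFinite ι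
  let L := FractionRing R
  let _ : Algebra L Ω := FractionRing.liftAlgebra R Ω
  have : IsScalarTower R L Ω := FractionRing.isScalarTower_liftAlgebra R Ω
  have : CharZero L := (algebraMap L Ω).charZero
  let M := IntermediateField.adjoin L (Set.range x)
  have halg : ∀ i, IsIntegral L (x i) := fun i =>
    ((IsFractionRing.isAlgebraic_iff R L Ω).1 (hx i)).isIntegral
  have : FiniteDimensional L M := IntermediateField.finiteDimensional_adjoin (by
    rintro _ ⟨i, rfl⟩; exact halg i)
  obtain ⟨θ₀, hθ₀⟩ := Field.exists_primitive_element L M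
  let θ : Ω := θ₀
  have hθint : IsIntegral L θ := (Algebra.IsIntegral.isIntegral (R := L) θ₀).map M.val
  have hh : ∀ i, ∃ h : L[X], aeval θ h = x i := fun i => by
    have h1 : (⟨x i, IntermediateField.subset_adjoin L _ ⟨i, rfl⟩⟩ : M) ∈
        (IntermediateField.adjoin L {θ₀}).toSubalgebra := by rw [hθ₀]; trivial
    rw [IntermediateField.adjoin_simple_toSubalgebra_of_isAlgebraic
      (Algebra.IsAlgebraic.isAlgebraic θ₀), Algebra.adjoin_singleton_eq_range_aeval] at h1
    obtain ⟨h, hh⟩ := h1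
    refine ⟨h, ?_⟩
    exact (aeval_algHom_apply M.val θ₀ h).trans (congrArg M.val hh)
  choose h hh using hh
  let p := minpoly L θ
  obtain ⟨⟨b, hb⟩, hbs⟩ := IsLocalization.exist_integer_multiples_of_finset (nonZeroDivisors R)
    (p.coeffs ∪ Finset.univ.biUnion fun i => (h i).coeffs)
  have hb0 : b ≠ 0 := nonZeroDivisors.ne_zero hb
  have hbL : algebraMap R L b ≠ 0 := by simpa using hb0
  let R₁ := Localization.Away b
  let j₁ : R₁ →+* L := IsLocalization.Away.lift b (g := algebraMap R L) hbL.isUnit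
  have hj₁ : ∀ r, j₁ (algebraMap R R₁ r) = algebraMap R L r := IsLocalization.Away.lift_eq b _
  have hj₁inj : Function.Injective j₁ := by
    refine (IsLocalization.lift_injective_iff _).2 fun r s => ?_
    rw [(IsFractionRing.injective R L).eq_iff]
    exact (IsLocalization.injective R₁ (powers_le_nonZeroDivisors_of_noZeroDivisors hb0)).eq_iff
  have hrange : ∀ a : L, a ∈ (p.coeffs ∪ Finset.univ.biUnion fun i => (h i).coeffs) →
      a ∈ Set.range j₁ := fun a ha => by
    obtain ⟨r, hr⟩ := hbs a ha
    refine ⟨IsLocalization.mk' R₁ r (⟨b, 1, pow_one b⟩ : Submonoid.powers b), ?_⟩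
    have h1 := congrArg j₁ (IsLocalization.mk'_spec R₁ r (⟨b, 1, pow_one b⟩ : Submonoid.powers b))
    rw [map_mul, hj₁, hj₁, hr] at h1
    refine mul_right_cancel₀ hbL (h1.trans ?_)
    rw [mul_comm, ← Algebra.smul_def]
  have hlift : ∀ q : L[X], q.coeffs ⊆ (p.coeffs ∪ Finset.univ.biUnion fun i => (h i).coeffs) →
      q ∈ lifts j₁ := fun q hq => by
    rw [lifts_iff_coeff_lifts]
    intro n
    by_cases hn : q.coeff n = 0
    · exact ⟨0, by rw [hn, map_zero]⟩
    · exact hrange _ (hq (coeff_mem_coeffs hn))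
  obtain ⟨p₁, hp₁, -, hp₁m⟩ := lifts_and_natDegree_eq_and_monic
    (hlift p Finset.subset_union_left) (minpoly.monic hθint)
  have hh₁ : ∀ i, ∃ g : R₁[X], g.map j₁ = h i := fun i =>
    (mem_lifts _).1 (hlift (h i) ((Finset.subset_biUnion_of_mem (fun i => (h i).coeffs)
      (Finset.mem_univ i)).trans Finset.subset_union_right))
  choose g hg using hh₁
  let ψ : R₁ →+* Ω := (algebraMap L Ω).comp j₁
  have hψ : ∀ q : R₁[X], eval₂ ψ θ q = aeval θ (q.map j₁) := fun q => by
    rw [aeval_def, eval₂_map]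
  have hψR : ψ.comp (algebraMap R R₁) = algebraMap R Ω := by
    ext r
    change algebraMap L Ω (j₁ _) = _
    rw [hj₁, ← IsScalarTower.algebraMap_apply]
  obtain ⟨c, hc, hcP⟩ := IsLocalization.integerNormalization_spec (Submonoid.powers b) p₁
  set P := IsLocalization.integerNormalization (Submonoid.powers b) p₁ with hP
  have hcP' : P.map (algebraMap R R₁) = C (algebraMap R R₁ c) * p₁ := by
    rw [hcP, ← smul_eq_C_mul, algebraMap_smul]
  have hevalP : ∀ (χ : R₁ →+* Ω) (u : Ω), P.eval₂ (χ.comp (algebraMap R R₁)) u =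
      χ (algebraMap R R₁ c) * p₁.eval₂ χ u := fun χ u => by
    rw [← eval₂_map, hcP', eval₂_mul, eval₂_C]
  have hcunit : ∀ χ : R₁ →+* Ω, χ (algebraMap R R₁ c) ≠ 0 := fun χ =>
    ((IsLocalization.map_units R₁ (⟨c, hc⟩ : Submonoid.powers b)).map χ).ne_zero
  refine ⟨b, hb0, P, θ, ?_, ?_, fun φ hφ θ' hθ' => ?_⟩
  · rw [aeval_def, ← hψR, hevalP, hψ, hp₁, minpoly.aeval, mul_zero]
  · have hd : (derivative P).map (algebraMap R R₁) = C (algebraMap R R₁ c) * derivative p₁ := by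
      rw [← derivative_map, hcP', derivative_C_mul]
    rw [aeval_def, ← hψR, ← eval₂_map, hd, eval₂_mul, eval₂_C, hψ, ← derivative_map, hp₁]
    refine mul_ne_zero (hcunit ψ) ?_
    exact (minpoly.irreducible hθint).separable.aeval_derivative_ne_zero (minpoly.aeval L θ)
  · let φ₁ : R₁ →+* Ω := IsLocalization.Away.lift b (g := φ) hφ.isUnit
    have hφ₁ : φ₁.comp (algebraMap R R₁) = φ := by
      ext r; exact IsLocalization.Away.lift_eq b hφ.isUnit r
    have hroot : p₁.eval₂ φ₁ θ' = 0 := by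
      rw [← hφ₁, hevalP] at hθ'
      exact (mul_eq_zero.1 hθ').resolve_left (hcunit φ₁)
    refine ⟨fun i => (g i).eval₂ φ₁ θ', fun Q hQ => ?_⟩
    let G : R₁[X] := MvPolynomial.eval₂ (C.comp (algebraMap R R₁)) g Q
    have hG : ∀ (χ : R₁ →+* Ω) (u : Ω), G.eval₂ χ u =
        MvPolynomial.eval₂ (χ.comp (algebraMap R R₁)) (fun i => (g i).eval₂ χ u) Q := fun χ u => by
      have := MvPolynomial.hom_eval₂ Q (C.comp (algebraMap R R₁)) (eval₂RingHom χ u) g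
      rw [coe_eval₂RingHom] at this
      refine this.trans ?_
      congr 1
      ext r
      simp
    have hGθ : aeval θ (G.map j₁) = 0 := by
      rw [← hψ, hG, hψR, ← hQ, MvPolynomial.aeval_def]
      congr 1
      ext i
      rw [hψ, hg, hh]
    have hdvd : p₁ ∣ G := by
      rw [← map_dvd_map j₁ hj₁inj hp₁m, hp₁]
      exact minpoly.dvd L θ hGθ
    obtain ⟨q, hq⟩ := hdvd
    rw [← hφ₁, ← hG, hq, eval₂_mul, hroot, zero_mul]

/-- A polynomial over an ordered field changes sign at a simple root. -/
theorem exists_eval_mul_eval_neg {Ω : Type*} [Field Ω] [LinearOrder Ω] [IsStrictOrderedRing Ω]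
    (P : Polynomial Ω) {θ : Ω} (h0 : P.eval θ = 0) (h1 : (derivative P).eval θ ≠ 0) :
    ∃ u v, P.eval u * P.eval v < 0 := by
  let _ : TopologicalSpace Ω := Preorder.topology Ω
  have : OrderTopology Ω := ⟨rfl⟩
  obtain ⟨q, rfl⟩ := dvd_iff_isRoot.2 h0
  have hq : q.eval θ ≠ 0 := by simpa using h1
  have hev : ∀ᶠ u in 𝓝 θ, 0 < q.eval u * q.eval θ :=
    (q.continuous.mul continuous_const).continuousAt.eventually
      (lt_mem_nhds (mul_self_pos.2 hq))
  obtain ⟨u, hu, hu'⟩ := ((hev.filter_mono nhdsWithin_le_nhds).and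
    (self_mem_nhdsWithin (s := Set.Iio θ) (a := θ))).exists
  obtain ⟨v, hv, hv'⟩ := ((hev.filter_mono nhdsWithin_le_nhds).and
    (self_mem_nhdsWithin (s := Set.Ioi θ) (a := θ))).exists
  refine ⟨u, v, ?_⟩
  have h2 : 0 < q.eval u * q.eval v := by
    have h3 : 0 < (q.eval u * q.eval v) * (q.eval θ * q.eval θ) := by nlinarith [mul_pos hu hv]
    exact (pos_iff_pos_of_mul_pos h3).2 (mul_self_pos.2 hq)
  have h4 : (u - θ) * (v - θ) < 0 := mul_neg_of_neg_of_pos (sub_neg.2 hu') (sub_pos.2 hv')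
  have h5 : eval u ((X - C θ) * q) * eval v ((X - C θ) * q) =
      ((u - θ) * (v - θ)) * (q.eval u * q.eval v) := by
    simp only [eval_mul, eval_sub, eval_X, eval_C]; ring
  rw [h5]
  exact mul_neg_of_neg_of_pos h4 h2

/-- Let the coordinate `x j` of a point over a real closed field be transcendental over `E`, and
let all coordinates be algebraic over `E(x j)`. Then there is a point with smaller `j`-th coordinate
that satisfies all polynomial equations over `E` satisfied by `x`. -/
theorem exists_lt_of_transcendental {E Ω ι : Type*} [Field E] [Field Ω] [LinearOrder Ω]
    [IsStrictOrderedRing Ω] [Algebra E Ω] [Finite ι]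
    (ivt : ∀ (P : Polynomial Ω) (u v : Ω), P.eval u * P.eval v < 0 → ∃ w, P.eval w = 0)
    (x : ι → Ω) (j : ι) (hj : Transcendental E (x j))
    (hx : ∀ i, IsAlgebraic (Algebra.adjoin E {x j}) (x i)) :
    ∃ x' : ι → Ω, x' j < x j ∧
      ∀ Q : MvPolynomial ι E, MvPolynomial.aeval x Q = 0 → MvPolynomial.aeval x' Q = 0 := by
  let _ : TopologicalSpace Ω := Preorder.topology Ω
  have : OrderTopology Ω := ⟨rfl⟩
  let z := x j
  let _ : Algebra E[X] Ω := (aeval z).toAlgebra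
  have hmap : ∀ r : E[X], algebraMap E[X] Ω r = aeval z r := fun _ => rfl
  have hinj : Function.Injective (algebraMap E[X] Ω) := transcendental_iff_injective.1 hj
  have : FaithfulSMul E[X] Ω := (faithfulSMul_iff_algebraMap_injective _ _).2 hinj
  have hx' : ∀ i, IsAlgebraic E[X] (x i) := fun i => by
    let f : E[X] →+* Algebra.adjoin E {z} := (aeval z).toRingHom.codRestrict
      (Algebra.adjoin E {z}) fun r => by
        rw [Algebra.adjoin_singleton_eq_range_aeval]; exact ⟨r, rfl⟩
    refine IsAlgebraic.of_ringHom_of_comp_eq f (RingHom.id Ω) (hx i) ?_ Function.injective_id rfl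
    rintro ⟨w, hw⟩
    have hw' := hw
    rw [Algebra.adjoin_singleton_eq_range_aeval] at hw'
    obtain ⟨r, hr⟩ := hw'
    exact ⟨r, Subtype.ext hr⟩
  obtain ⟨d, hd, P, θ, hP0, hP1, hspec⟩ := exists_specialization_of_isAlgebraic x hx'
  let φ : Ω → E[X] →+* Ω := fun t => (aeval t).toRingHom
  have hφz : φ z = algebraMap E[X] Ω := rfl
  obtain ⟨u, v, huv⟩ := exists_eval_mul_eval_neg (P.map (φ z)) (θ := θ)
    (by rw [eval_map, hφz]; exact hP0) (by rw [derivative_map, eval_map, hφz]; exact hP1)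
  let F : Ω → Polynomial Ω := fun u => P.eval₂ (mapRingHom (algebraMap E Ω)) (C u)
  have hF : ∀ u t, (F u).eval t = (P.map (φ t)).eval u := fun u t => by
    have h1 := hom_eval₂ P (mapRingHom (algebraMap E Ω)) (evalRingHom t) (C u)
    rw [coe_evalRingHom, eval_C] at h1
    rw [h1, eval_map]
    congr 1
    refine RingHom.ext fun r => ?_
    simp [φ, aeval_def, eval_map]
  have hdz : (d.map (algebraMap E Ω)).eval z ≠ 0 := by
    rw [eval_map_algebraMap]
    exact fun h => hd (hinj (by rw [hmap, h, map_zero]))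
  have ev1 : ∀ᶠ t in 𝓝 z, (F u * F v).eval t < 0 :=
    (F u * F v).continuous.continuousAt.eventually (gt_mem_nhds (by
      simpa only [eval_mul, hF] using huv))
  have ev2 : ∀ᶠ t in 𝓝 z, (d.map (algebraMap E Ω)).eval t ≠ 0 :=
    (d.map (algebraMap E Ω)).continuous.continuousAt.eventually_ne hdz
  obtain ⟨t, ⟨ht1, ht2⟩, ht⟩ := (((ev1.and ev2).filter_mono nhdsWithin_le_nhds).and
    (self_mem_nhdsWithin (s := Set.Iio z) (a := z))).exists
  rw [eval_mul, hF, hF] at ht1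
  obtain ⟨θ', hθ'⟩ := ivt _ _ _ ht1
  rw [eval_map_algebraMap] at ht2
  obtain ⟨x', hx'⟩ := hspec (φ t) ht2 θ' (by rwa [eval_map] at hθ')
  have hx'j : x' j = t := by
    have h1 := hx' (MvPolynomial.X j - MvPolynomial.C X) (by
      rw [map_sub, MvPolynomial.aeval_X, MvPolynomial.algHom_C, hmap, aeval_X, sub_self])
    rw [MvPolynomial.eval₂_sub, MvPolynomial.eval₂_X, MvPolynomial.eval₂_C] at h1
    exact (sub_eq_zero.1 h1).trans (aeval_X t)
  refine ⟨x', by rw [hx'j]; exact ht, fun Q hQ => ?_⟩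
  have h1 := hx' (Q.map C) (by
    rw [MvPolynomial.aeval_def, MvPolynomial.eval₂_map, ← hQ, MvPolynomial.aeval_def]
    congr 1
    ext r
    simp [hmap])
  rw [MvPolynomial.eval₂_map] at h1
  rw [← h1, MvPolynomial.aeval_def]
  congr 1
  ext r
  simp [φ]

open scoped IntermediateField.algebraAdjoinAdjoin in
/-- Over any transcendental element `z` of an extension `Ω` of `F` there is an intermediate field
`E` algebraically closed in `Ω` such that `{z}` is a transcendence basis of `Ω` over `E`. -/
theorem exists_intermediateField_transcendental {F Ω : Type*} [Field F] [Field Ω] [Algebra F Ω]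
    {z : Ω} (hz : Transcendental F z) :
    ∃ E : IntermediateField F Ω, Transcendental E z ∧
      (∀ w : Ω, IsAlgebraic (Algebra.adjoin E {z}) w) ∧ ∀ w : Ω, IsAlgebraic F w → w ∈ E := by
  have hind : AlgebraicIndepOn F id {z} :=
    (algebraicIndependent_singleton_iff (R := F) (x := fun i : ({z} : Set Ω) => (i : Ω))
      ⟨z, rfl⟩).2 hz
  obtain ⟨t, hjt, ht⟩ := exists_isTranscendenceBasis_superset hind
  rw [Set.singleton_subset_iff] at hjt
  let s : Set Ω := t \ {z}
  let K := IntermediateField.adjoin F s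
  have htr' : Transcendental (Algebra.adjoin F s) z := by
    have := ht.1.transcendental_adjoin (s := {⟨z, hjt⟩}ᶜ) (i := ⟨z, hjt⟩) (by simp)
    have himg : (Subtype.val '' ({⟨z, hjt⟩}ᶜ : Set t)) = s := by
      ext w; simp [s]
    rwa [himg] at this
  have htrK : Transcendental K z := fun h => htr'
    ((IsFractionRing.isAlgebraic_iff (Algebra.adjoin F s) K Ω).2 h)
  obtain ⟨E, hmemE, htrE⟩ : ∃ E : IntermediateField F Ω,
      (∀ w : Ω, IsAlgebraic K w → w ∈ E) ∧ Transcendental E z := by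
    refine ⟨(algebraicClosure K Ω).restrictScalars F, fun w => mem_algebraicClosure_iff.2,
      fun h => htrK ?_⟩
    have h' : IsAlgebraic (algebraicClosure K Ω) z := h
    exact h'.restrictScalars K
  have hsE : ∀ w ∈ s, w ∈ E := fun w hw =>
    hmemE w (isAlgebraic_algebraMap (⟨w, IntermediateField.subset_adjoin F s hw⟩ : K))
  have hle : Algebra.adjoin F t ≤ (Algebra.adjoin E {z}).restrictScalars F := by
    refine Algebra.adjoin_le fun w hw => ?_
    by_cases h : w = z
    · exact Algebra.subset_adjoin (R := E) (s := {z}) h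
    · exact Subalgebra.algebraMap_mem (Algebra.adjoin E {z}) (⟨w, hsE w ⟨hw, h⟩⟩ : E)
  refine ⟨E, htrE, fun w => ?_, fun w hw => ?_⟩
  · have h1 := ht.isAlgebraic
    rw [Subtype.range_coe] at h1
    exact (h1.isAlgebraic w).ringHom_of_comp_eq (Subalgebra.inclusion hle).toRingHom
      (RingHom.id Ω) (Subalgebra.inclusion_injective hle) rfl
  · exact hmemE w (hw.extendScalars (algebraMap F K).injective)

/-- If no point satisfying the same polynomial equations over `F` precedes `x` in the
lexicographic order, then all coordinates of `x` are algebraic over `F`. -/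
theorem isAlgebraic_of_lex_minimal {F Ω : Type*} [Field F] [Field Ω] [LinearOrder Ω]
    [IsStrictOrderedRing Ω] [Algebra F Ω]
    (ivt : ∀ (P : Polynomial Ω) (u v : Ω), P.eval u * P.eval v < 0 → ∃ w, P.eval w = 0)
    {N : ℕ} (x : Fin N → Ω)
    (hmin : ∀ x' : Fin N → Ω,
      (∀ Q : MvPolynomial (Fin N) F, MvPolynomial.aeval x Q = 0 → MvPolynomial.aeval x' Q = 0) →
      ∀ j, (∀ i < j, x' i = x i) → x j ≤ x' j) (j : Fin N) : IsAlgebraic F (x j) := by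
  induction j using WellFoundedLT.induction with
  | _ j ih =>
  by_contra htr
  obtain ⟨E, htrE, halg, hE⟩ := exists_intermediateField_transcendental htr
  obtain ⟨x', hlt, hx'⟩ := exists_lt_of_transcendental ivt x j htrE fun i => halg _
  refine absurd (hmin x' (fun Q hQ => ?_) j fun i hi => ?_) (not_le.2 hlt)
  · have := hx' (Q.map (algebraMap F E)) (by rwa [MvPolynomial.aeval_map_algebraMap])
    rwa [MvPolynomial.aeval_map_algebraMap] at this
  · have := hx' (MvPolynomial.X i - MvPolynomial.C ⟨x i, hE _ (ih i hi)⟩) (by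
      rw [map_sub, MvPolynomial.aeval_X, MvPolynomial.algHom_C]; exact sub_self _)
    rw [map_sub, MvPolynomial.aeval_X, MvPolynomial.algHom_C] at this
    exact sub_eq_zero.1 this

end Specialization
end PolyInfinity

namespace PolyInfinity

section CurveSelection

/-- The embedding of constants into germs of sequences. -/
def germConst (U : Ultrafilter ℕ) (R : Type*) [CommRing R] : R →+* Germ (U : Filter ℕ) R :=
  (Germ.coeRingHom (U : Filter ℕ)).comp (Pi.constRingHom ℕ R)

theorem germ_mvPolynomial_eval₂ {U : Ultrafilter ℕ} {R σ : Type*} [CommRing R]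
    (f : σ → ℕ → R) (Q : MvPolynomial σ R) :
    MvPolynomial.eval₂ (germConst U R) (fun s => (f s : Germ (U : Filter ℕ) R)) Q =
      ((fun k => MvPolynomial.eval (fun s => f s k) Q : ℕ → R) : Germ (U : Filter ℕ) R) := by
  have h := MvPolynomial.hom_eval₂ Q (Pi.constRingHom ℕ R) (Germ.coeRingHom (U : Filter ℕ)) f
  refine h.symm.trans (congrArg _ (funext fun k => ?_))
  exact MvPolynomial.hom_eval₂ Q (Pi.constRingHom ℕ R) (Pi.evalRingHom (fun _ => R) k) f

theorem germ_polynomial_eval₂ {U : Ultrafilter ℕ} {R : Type*} [CommRing R]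
    (f : ℕ → R) (P : Polynomial R) :
    P.eval₂ (germConst U R) (f : Germ (U : Filter ℕ) R) =
      ((fun k => P.eval (f k) : ℕ → R) : Germ (U : Filter ℕ) R) := by
  have h := Polynomial.hom_eval₂ P (Pi.constRingHom ℕ R) (Germ.coeRingHom (U : Filter ℕ)) f
  refine h.symm.trans (congrArg _ (funext fun k => ?_))
  exact Polynomial.hom_eval₂ P (Pi.constRingHom ℕ R) (Pi.evalRingHom (fun _ => R) k) f

theorem germ_polynomial_evalEval {U : Ultrafilter ℕ} {R : Type*} [CommRing R]
    (y f : ℕ → R) (P : Polynomial (Polynomial R)) :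
    P.eval₂ (Polynomial.eval₂RingHom (germConst U R) (y : Germ (U : Filter ℕ) R)) f =
      ((fun k => P.evalEval (y k) (f k) : ℕ → R) : Germ (U : Filter ℕ) R) := by
  have h := Polynomial.hom_eval₂ P (Polynomial.eval₂RingHom (Pi.constRingHom ℕ R) y)
    (Germ.coeRingHom (U : Filter ℕ)) f
  have e1 : (Germ.coeRingHom (U : Filter ℕ)).comp
      (Polynomial.eval₂RingHom (Pi.constRingHom ℕ R) y) =
      Polynomial.eval₂RingHom (germConst U R) (y : Germ (U : Filter ℕ) R) := by
    refine Polynomial.ringHom_ext (fun a => ?_) ?_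
    · simp [germConst]
    · simp
  rw [e1] at h
  refine h.symm.trans (congrArg _ (funext fun k => ?_))
  have h2 := Polynomial.hom_eval₂ P (Polynomial.eval₂RingHom (Pi.constRingHom ℕ R) y)
    (Pi.evalRingHom (fun _ => R) k) f
  have e2 : (Pi.evalRingHom (fun _ => R) k).comp
      (Polynomial.eval₂RingHom (Pi.constRingHom ℕ R) y) = Polynomial.evalRingHom (y k) := by
    refine Polynomial.ringHom_ext (fun a => ?_) ?_
    · simp
    · simp
  rw [e2, Polynomial.eval₂_evalRingHom] at h2
  exact h2

/-- The intermediate value theorem for polynomials over the hyperreal numbers. -/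
theorem germ_exists_root {U : Ultrafilter ℕ} (P : Polynomial (Germ (U : Filter ℕ) ℝ))
    (u v : Germ (U : Filter ℕ) ℝ) (h : P.eval u * P.eval v < 0) : ∃ w, P.eval w = 0 := by
  have hsurj : Function.Surjective (Germ.coeRingHom (R := ℝ) (U : Filter ℕ)) := Quot.exists_rep
  obtain ⟨p, rfl⟩ := Polynomial.map_surjective _ hsurj P
  obtain ⟨u, rfl⟩ := hsurj u
  obtain ⟨v, rfl⟩ := hsurj v
  have hev : ∀ f : ℕ → ℝ, (p.map (Germ.coeRingHom (U : Filter ℕ))).eval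
      (Germ.coeRingHom (U : Filter ℕ) f) =
      ((fun k => (p.map (Pi.evalRingHom (fun _ => ℝ) k)).eval (f k) : ℕ → ℝ) :
        Germ (U : Filter ℕ) ℝ) := fun f => by
    rw [Polynomial.eval_map_apply]
    refine congrArg _ (funext fun k => ?_)
    exact (Polynomial.eval_map_apply (Pi.evalRingHom (fun _ => ℝ) k) f (p := p)).symm
  rw [hev, hev, ← Germ.coe_mul] at h
  have h' : ∀ᶠ k in (U : Filter ℕ), ∃ w, (p.map (Pi.evalRingHom (fun _ => ℝ) k)).eval w = 0 := by
    refine (Germ.coe_lt.1 h).mono fun k hk => ?_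
    have hk' : (p.map (Pi.evalRingHom (fun _ => ℝ) k)).eval (u k) *
      (p.map (Pi.evalRingHom (fun _ => ℝ) k)).eval (v k) < 0 := hk
    have h0 : (0 : ℝ) ∈ Set.uIcc ((p.map (Pi.evalRingHom (fun _ => ℝ) k)).eval (u k))
        ((p.map (Pi.evalRingHom (fun _ => ℝ) k)).eval (v k)) := by
      rw [Set.mem_uIcc]
      rcases mul_neg_iff.1 hk' with ⟨h1, h2⟩ | ⟨h1, h2⟩
      · exact Or.inr ⟨h2.le, h1.le⟩
      · exact Or.inl ⟨h1.le, h2.le⟩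
    obtain ⟨w, -, hw⟩ := intermediate_value_uIcc
      (Polynomial.continuous (p.map (Pi.evalRingHom (fun _ => ℝ) k))).continuousOn h0
    exact ⟨w, hw⟩
  obtain ⟨w, hw⟩ := h'.choice
  exact ⟨Germ.coeRingHom (U : Filter ℕ) w, by rw [hev]; exact Germ.coe_eq.2 hw⟩

theorem exists_lex_minimal {N : ℕ} {S : Set (Fin N → ℝ)} (hS : IsCompact S) (hne : S.Nonempty) :
    ∃ x ∈ S, ∀ x' ∈ S, ∀ j, (∀ i < j, x' i = x i) → x j ≤ x' j := by
  suffices H : ∀ n : ℕ, n ≤ N → ∃ x ∈ S, ∀ x' ∈ S, ∀ j : Fin N, (j : ℕ) < n →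
      (∀ i < j, x' i = x i) → x j ≤ x' j by
    obtain ⟨x, hx, h⟩ := H N le_rfl
    exact ⟨x, hx, fun x' hx' j => h x' hx' j j.2⟩
  intro n
  induction n with
  | zero => exact fun _ => hne.imp fun x hx => ⟨hx, fun _ _ _ h => absurd h (Nat.not_lt_zero _)⟩
  | succ n ih =>
    intro hn
    obtain ⟨x, hx, h⟩ := ih (Nat.le_of_succ_le hn)
    have hT : IsCompact (S ∩ {x' | ∀ i : Fin N, (i : ℕ) < n → x' i = x i}) := by
      refine hS.inter_right ?_
      simp only [Set.ofPred_forall]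
      exact isClosed_iInter fun i => isClosed_iInter fun _ =>
        isClosed_eq (continuous_apply i) continuous_const
    obtain ⟨w, hw, hmin⟩ := hT.exists_isMinOn ⟨x, hx, fun _ _ => rfl⟩
      (continuous_apply (⟨n, hn⟩ : Fin N)).continuousOn
    refine ⟨w, hw.1, fun x' hx' j hj hij => ?_⟩
    rcases Nat.lt_succ_iff_lt_or_eq.1 hj with hj | hj
    · rw [hw.2 j hj]
      exact h x' hx' j hj fun i hi => (hij i hi).trans (hw.2 i (lt_trans hi hj))
    · obtain rfl : j = ⟨n, hn⟩ := Fin.ext hj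
      exact hmin ⟨hx', fun i hi => (hij i hi).trans (hw.2 i hi)⟩

open scoped IntermediateField.algebraAdjoinAdjoin in
theorem exists_polynomial_of_isAlgebraic_adjoin {k Ω : Type*} [Field k] [Field Ω] [Algebra k Ω]
    {y w : Ω} (hw : IsAlgebraic (IntermediateField.adjoin k {y}) w) :
    ∃ P : Polynomial (Polynomial k), P ≠ 0 ∧
      P.eval₂ (Polynomial.aeval y : Polynomial k →ₐ[k] Ω).toRingHom w = 0 := by
  rw [← IsFractionRing.isAlgebraic_iff (Algebra.adjoin k {y})] at hw
  obtain ⟨p, hp, hpw⟩ := hw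
  let f : Polynomial k →+* Algebra.adjoin k {y} :=
    (Polynomial.aeval y : Polynomial k →ₐ[k] Ω).toRingHom.codRestrict (Algebra.adjoin k {y})
      fun r => by rw [Algebra.adjoin_singleton_eq_range_aeval]; exact ⟨r, rfl⟩
  have hf : Function.Surjective f := by
    rintro ⟨z, hz⟩
    have hz' := hz
    rw [Algebra.adjoin_singleton_eq_range_aeval] at hz'
    obtain ⟨r, hr⟩ := hz'
    exact ⟨r, Subtype.ext hr⟩
  obtain ⟨P, rfl⟩ := Polynomial.map_surjective f hf p
  refine ⟨P, fun h => hp (by rw [h, Polynomial.map_zero]), ?_⟩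
  rw [Polynomial.aeval_def, Polynomial.eval₂_map] at hpw
  exact hpw

/-- Curve selection: if compact sets `S k` are defined by polynomial equations depending
polynomially on a parameter `y k`, then one can choose points of the `S k` whose coordinates are,
along an ultrafilter, algebraic functions of the parameter. -/
theorem exists_algebraic_selection (U : Ultrafilter ℕ) {ι κ : Type*} [Finite ι] [Finite κ]
    (q : κ → MvPolynomial (Option ι) ℝ) (y : ℕ → ℝ)
    (hc : ∀ k, IsCompact {x : ι → ℝ | ∀ a, MvPolynomial.eval (fun o => o.elim (y k) x) (q a) = 0})
    (hne : ∀ k, ∃ x : ι → ℝ, ∀ a, MvPolynomial.eval (fun o => o.elim (y k) x) (q a) = 0) :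
    ∃ x : ℕ → ι → ℝ,
      (∀ k a, MvPolynomial.eval (fun o => o.elim (y k) (x k)) (q a) = 0) ∧
      ∀ i, ∃ P : Polynomial (Polynomial ℝ), P ≠ 0 ∧
        ∀ᶠ k in (U : Filter ℕ), P.evalEval (y k) (x k i) = 0 := by
  obtain ⟨N, ⟨e⟩⟩ := Finite.exists_equiv_fin ι
  have hlex : ∀ k, ∃ x : Fin N → ℝ,
      (∀ a, MvPolynomial.eval (fun o => o.elim (y k) (x ∘ e)) (q a) = 0) ∧
      ∀ x' : Fin N → ℝ, (∀ a, MvPolynomial.eval (fun o => o.elim (y k) (x' ∘ e)) (q a) = 0) →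
        ∀ j, (∀ i < j, x' i = x i) → x j ≤ x' j := fun k => by
    let φ : (Fin N → ℝ) ≃ₜ (ι → ℝ) := (Homeomorph.piCongrLeft (Y := fun _ => ℝ) e).symm
    have hφ : ∀ x, φ x = x ∘ e := fun x => rfl
    obtain ⟨x, hx, hmin⟩ := exists_lex_minimal (φ.isClosedEmbedding.isCompact_preimage (hc k)) (by
      obtain ⟨x, hx⟩ := hne k
      exact ⟨φ.symm x, by rw [Set.mem_preimage, φ.apply_symm_apply]; exact hx⟩)
    exact ⟨x, hx, hmin⟩
  choose x hx hmin using hlex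
  refine ⟨fun k => x k ∘ e, hx, fun i => ?_⟩
  let _ : Algebra ℝ (Germ (U : Filter ℕ) ℝ) := (germConst U ℝ).toAlgebra
  let Y : Germ (U : Filter ℕ) ℝ := (y : Germ (U : Filter ℕ) ℝ)
  let F := IntermediateField.adjoin ℝ {Y}
  let X : Fin N → Germ (U : Filter ℕ) ℝ := fun i => ((fun k => x k i : ℕ → ℝ) : Germ _ ℝ)
  have halg : IsAlgebraic F (X (e i)) := by
    refine isAlgebraic_of_lex_minimal germ_exists_root X (fun x' hx' j hj => ?_) (e i)
    choose f hf using fun i => Quot.exists_rep (x' i)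
    have hf' : ∀ i, x' i = ((f i : ℕ → ℝ) : Germ (U : Filter ℕ) ℝ) := fun i => (hf i).symm
    obtain rfl : x' = fun i => ((f i : ℕ → ℝ) : Germ (U : Filter ℕ) ℝ) := funext hf'
    let Q : κ → MvPolynomial (Fin N) F := fun a =>
      MvPolynomial.eval₂ (MvPolynomial.C.comp (algebraMap ℝ F))
        (fun o => o.elim (MvPolynomial.C ⟨Y, IntermediateField.mem_adjoin_simple_self ℝ Y⟩)
          fun i => MvPolynomial.X (e i)) (q a)
    have hQ : ∀ (g : Fin N → ℕ → ℝ) (a : κ),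
        MvPolynomial.aeval (fun i => ((g i : ℕ → ℝ) : Germ (U : Filter ℕ) ℝ)) (Q a) =
        ((fun k => MvPolynomial.eval (fun o => o.elim (y k) ((fun i => g i k) ∘ e)) (q a) : ℕ → ℝ) :
          Germ (U : Filter ℕ) ℝ) := fun g a => by
      have h1 := germ_mvPolynomial_eval₂ (U := U)
        (fun o : Option ι => o.elim y fun i => g (e i)) (q a)
      have h2 := MvPolynomial.hom_eval₂ (q a) (MvPolynomial.C.comp (algebraMap ℝ F))
        (MvPolynomial.aeval (R := F)
          (fun i => ((g i : ℕ → ℝ) : Germ (U : Filter ℕ) ℝ))).toRingHom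
        (fun o => o.elim (MvPolynomial.C ⟨Y, IntermediateField.mem_adjoin_simple_self ℝ Y⟩)
          fun i => MvPolynomial.X (e i))
      refine h2.trans (Eq.trans ?_ (h1.trans ?_))
      · congr 1
        · ext r
          simp
          rfl
        · funext o
          cases o <;> simp [Y]
      · refine congrArg _ (funext fun k => ?_)
        refine congrArg (fun h => MvPolynomial.eval h (q a)) (funext fun o => ?_)
        cases o <;> rfl
    have hmem : ∀ᶠ k in (U : Filter ℕ),
        ∀ a, MvPolynomial.eval (fun o => o.elim (y k) ((fun i => f i k) ∘ e)) (q a) = 0 := by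
      refine eventually_all.2 fun a => ?_
      have h1 := hx' (Q a) (by
        rw [hQ]
        exact Germ.coe_eq.2 (Eventually.of_forall fun k => hx k a))
      rw [hQ] at h1
      exact Germ.coe_eq.1 h1
    have hagree : ∀ᶠ k in (U : Filter ℕ), ∀ i, i < j → f i k = x k i :=
      eventually_all.2 fun i => by
        by_cases hi : i < j
        · exact (Germ.coe_eq.1 (hj i hi)).mono fun k hk _ => hk
        · exact Eventually.of_forall fun k h => absurd h hi
    refine Germ.coe_le.2 ((hmem.and hagree).mono fun k hk => ?_)
    exact hmin k (fun i => f i k) hk.1 j hk.2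
  obtain ⟨P, hP, hP0⟩ := exists_polynomial_of_isAlgebraic_adjoin halg
  refine ⟨P, hP, ?_⟩
  have h1 := germ_polynomial_evalEval (U := U) y (fun k => x k (e i)) P
  have h2 : (Polynomial.aeval Y : Polynomial ℝ →ₐ[ℝ] Germ (U : Filter ℕ) ℝ).toRingHom =
      Polynomial.eval₂RingHom (germConst U ℝ) Y := rfl
  rw [h2, h1] at hP0
  exact Germ.coe_eq.1 hP0

end CurveSelection
end PolyInfinity

namespace PolyInfinity

section BoundedGerms

/-- The valuation ring of germs of sequences bounded along an ultrafilter. -/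
def boundedGerms (U : Ultrafilter ℕ) : ValuationSubring (Germ (U : Filter ℕ) ℂ) where
  carrier := {a | ∃ f : ℕ → ℂ, (f : Germ (U : Filter ℕ) ℂ) = a ∧
    ∃ C : ℝ, ∀ᶠ k in (U : Filter ℕ), ‖f k‖ ≤ C}
  mul_mem' := by
    rintro _ _ ⟨f, rfl, C, hf⟩ ⟨g, rfl, B, hg⟩
    refine ⟨f * g, rfl, C * B, ?_⟩
    filter_upwards [hf, hg] with k h1 h2
    rw [Pi.mul_apply, norm_mul]
    exact mul_le_mul h1 h2 (norm_nonneg _) ((norm_nonneg _).trans h1)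
  one_mem' := ⟨1, rfl, 1, Eventually.of_forall fun k => by simp⟩
  add_mem' := by
    rintro _ _ ⟨f, rfl, C, hf⟩ ⟨g, rfl, B, hg⟩
    refine ⟨f + g, rfl, C + B, ?_⟩
    filter_upwards [hf, hg] with k h1 h2
    exact (norm_add_le _ _).trans (add_le_add h1 h2)
  zero_mem' := ⟨0, rfl, 0, Eventually.of_forall fun k => by simp⟩
  neg_mem' := by
    rintro _ ⟨f, rfl, C, hf⟩
    refine ⟨-f, rfl, C, ?_⟩
    filter_upwards [hf] with k h1
    rwa [Pi.neg_apply, norm_neg]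
  mem_or_inv_mem' := by
    intro a
    obtain ⟨f, rfl⟩ := Quot.exists_rep a
    by_cases h : ∀ᶠ k in (U : Filter ℕ), ‖f k‖ ≤ 1
    · exact Or.inl ⟨f, rfl, 1, h⟩
    · refine Or.inr ⟨f⁻¹, rfl, 1, ?_⟩
      filter_upwards [Ultrafilter.eventually_not.2 h] with k hk
      rw [Pi.inv_apply, norm_inv]
      exact inv_le_one_of_one_le₀ (not_le.1 hk).le

theorem coe_mem_boundedGerms {U : Ultrafilter ℕ} {f : ℕ → ℂ} :
    (f : Germ (U : Filter ℕ) ℂ) ∈ boundedGerms U ↔ ∃ C : ℝ, ∀ᶠ k in (U : Filter ℕ), ‖f k‖ ≤ C := by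
  constructor
  · rintro ⟨g, hg, C, hC⟩
    refine ⟨C, ?_⟩
    filter_upwards [hC, Germ.coe_eq.1 hg] with k h1 h2
    rwa [← h2]
  · rintro ⟨C, hC⟩
    exact ⟨f, rfl, C, hC⟩

theorem valuationSubring_valuation_lt_one_iff {K : Type*} [Field K] (O : ValuationSubring K)
    {a : K} (ha : a ≠ 0) : O.valuation a < 1 ↔ a⁻¹ ∉ O := by
  have hv0 : O.valuation a ≠ 0 := (Valuation.ne_zero_iff _).2 ha
  rw [← ValuationSubring.valuation_le_one_iff, map_inv₀, not_le, one_lt_inv₀ (zero_lt_iff.2 hv0)]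

theorem boundedGerms_valuation_lt_one {U : Ultrafilter ℕ} {f : ℕ → ℂ} :
    (boundedGerms U).valuation (f : Germ (U : Filter ℕ) ℂ) < 1 ↔
      Tendsto f (U : Filter ℕ) (𝓝 0) := by
  set v := (boundedGerms U).valuation with hv
  have hinv : ((f : Germ (U : Filter ℕ) ℂ))⁻¹ = ((f⁻¹ : ℕ → ℂ) : Germ (U : Filter ℕ) ℂ) := rfl
  by_cases h0 : (f : Germ (U : Filter ℕ) ℂ) = 0
  · refine iff_of_true (by rw [h0, map_zero]; exact zero_lt_one) ?_
    have h1 : f =ᶠ[(U : Filter ℕ)] fun _ => 0 := Germ.coe_eq.1 h0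
    exact tendsto_const_nhds.congr' h1.symm
  have hne : ∀ᶠ k in (U : Filter ℕ), f k ≠ 0 :=
    Ultrafilter.eventually_not.2 fun h => h0 (Germ.coe_eq.2 h)
  rw [hv, valuationSubring_valuation_lt_one_iff _ h0, hinv, coe_mem_boundedGerms]
  rw [tendsto_zero_iff_norm_tendsto_zero, Metric.tendsto_nhds]
  constructor
  · intro h ε hε
    have h2 := Ultrafilter.eventually_not.2 fun h' => h ⟨ε⁻¹, h'⟩
    filter_upwards [h2, hne] with k hk hk0
    rw [Pi.inv_apply, norm_inv, not_le] at hk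
    rw [dist_zero_right, norm_norm]
    exact (inv_lt_inv₀ hε (norm_pos_iff.2 hk0)).1 hk
  · rintro h ⟨C, hC⟩
    obtain ⟨k, h2, h3, h4⟩ := ((h (|C| + 1)⁻¹ (by positivity)).and (hC.and hne)).exists
    rw [dist_zero_right, norm_norm] at h2
    rw [Pi.inv_apply, norm_inv] at h3
    have h5 := (lt_inv_comm₀ (norm_pos_iff.2 h4) (by positivity)).1 h2
    linarith [le_abs_self C]

theorem boundedGerms_exists_residue {U : Ultrafilter ℕ} {a : Germ (U : Filter ℕ) ℂ}
    (ha : a ∈ boundedGerms U) :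
    ∃ c : ℂ, (boundedGerms U).valuation (a - germConst U ℂ c) < 1 := by
  obtain ⟨f, rfl, C, hC⟩ := ha
  obtain ⟨c, -, hc⟩ := (isCompact_closedBall (0 : ℂ) C).ultrafilter_le_nhds' (U.map f)
    (hC.mono fun k hk => by simpa using hk)
  have h1 : Tendsto f (U : Filter ℕ) (𝓝 c) := hc
  refine ⟨c, ?_⟩
  have h2 : (f : Germ (U : Filter ℕ) ℂ) - germConst U ℂ c =
    ((fun k => f k - c : ℕ → ℂ) : Germ (U : Filter ℕ) ℂ) := rfl
  rw [h2, boundedGerms_valuation_lt_one]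
  simpa using h1.sub_const c

theorem derivation_mvPolynomial_aeval {R A ι : Type*} [CommRing R] [CommRing A] [Algebra R A]
    [Fintype ι] (D : Derivation R A A) (w : ι → A) (Q : MvPolynomial ι R) :
    D (MvPolynomial.aeval w Q) =
      ∑ i, MvPolynomial.aeval w (MvPolynomial.pderiv i Q) * D (w i) := by
  induction Q using MvPolynomial.induction_on with
  | C a => simp
  | add p q hp hq => simp only [map_add, hp, hq, add_mul, Finset.sum_add_distrib]
  | mul_X p i hp =>
    classical
    have h : ∀ j, MvPolynomial.aeval w (MvPolynomial.pderiv j (p * MvPolynomial.X i)) * D (w j) =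
        w i * (MvPolynomial.aeval w (MvPolynomial.pderiv j p) * D (w j)) +
          MvPolynomial.aeval w p * (if i = j then D (w j) else 0) := fun j => by
      rw [MvPolynomial.pderiv_mul, map_add, map_mul, map_mul, MvPolynomial.aeval_X,
        MvPolynomial.pderiv_X]
      by_cases hij : i = j
      · subst hij
        rw [Pi.single_eq_same, if_pos rfl, map_one]; ring
      · rw [Pi.single_eq_of_ne hij, if_neg hij, map_zero]; ring
    rw [map_mul, D.leibniz, hp, MvPolynomial.aeval_X, Finset.sum_congr rfl fun j _ => h j,
      Finset.sum_add_distrib, ← Finset.mul_sum, ← Finset.mul_sum,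
      Finset.sum_ite_eq Finset.univ i, if_pos (Finset.mem_univ i), smul_eq_mul, smul_eq_mul,
      add_comm]

theorem germ_transcendental_of_tendsto_zero {U : Ultrafilter ℕ} {y : ℕ → ℂ}
    (hy : Tendsto y (U : Filter ℕ) (𝓝 0)) (hy0 : ∀ᶠ k in (U : Filter ℕ), y k ≠ 0)
    {p : Polynomial ℂ} (hp : ∀ᶠ k in (U : Filter ℕ), p.eval (y k) = 0) : p = 0 := by
  by_contra hp0
  have hfin : ((p.roots.toFinset : Set ℂ) \ {0}).Finite := p.roots.toFinset.finite_toSet.sdiff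
  have hmem : ((p.roots.toFinset : Set ℂ) \ {0})ᶜ ∈ 𝓝 (0 : ℂ) :=
    hfin.isClosed.isOpen_compl.mem_nhds (by simp)
  obtain ⟨k, h1, h2, h3⟩ := ((hy.eventually hmem).and (hy0.and hp)).exists
  exact h1 ⟨by simpa [hp0] using h3, h2⟩

open Polynomial in
/-- Let the sequences `w i` be algebraic functions of `y → 0`. The velocities `δ i` of the `w i`
with respect to `log y` have the property that every polynomial in the `w i` that stays bounded has
velocity tending to zero. -/
theorem exists_velocity (U : Ultrafilter ℕ) {ι : Type*} [Fintype ι] {y : ℕ → ℂ}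
    (hy : Tendsto y (U : Filter ℕ) (𝓝 0)) (hy0 : ∀ᶠ k in (U : Filter ℕ), y k ≠ 0)
    (w : ι → ℕ → ℂ)
    (hw : ∀ i, ∃ P : Polynomial (Polynomial ℂ), P ≠ 0 ∧
      ∀ᶠ k in (U : Filter ℕ), P.evalEval (y k) (w i k) = 0) :
    ∃ δ : ι → ℕ → ℂ,
      (∀ Q : MvPolynomial ι ℂ,
        (∃ C : ℝ, ∀ᶠ k in (U : Filter ℕ), ‖MvPolynomial.eval (fun i => w i k) Q‖ ≤ C) →
        Tendsto (fun k => ∑ i, MvPolynomial.eval (fun i => w i k) (MvPolynomial.pderiv i Q) * δ i k)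
          (U : Filter ℕ) (𝓝 0)) ∧
      ∀ Q : MvPolynomial ι ℂ,
        (∀ᶠ k in (U : Filter ℕ), y k * MvPolynomial.eval (fun i => w i k) Q = 1) →
        ∀ᶠ k in (U : Filter ℕ),
          ∑ i, MvPolynomial.eval (fun i => w i k) (MvPolynomial.pderiv i Q) * δ i k =
            - MvPolynomial.eval (fun i => w i k) Q := by
  let Ω := Germ (U : Filter ℕ) ℂ
  let _ : Algebra ℂ Ω := (germConst U ℂ).toAlgebra
  let Y : Ω := (y : Germ (U : Filter ℕ) ℂ)
  let _ : Algebra ℂ[X] Ω := (aeval Y).toAlgebra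
  have : IsScalarTower ℂ ℂ[X] Ω := IsScalarTower.of_algebraMap_eq fun c => (aeval_C Y c).symm
  have hinj : Function.Injective (algebraMap ℂ[X] Ω) := by
    refine (injective_iff_map_eq_zero _).2 fun p hp => ?_
    have h1 := germ_polynomial_eval₂ (U := U) y p
    exact germ_transcendental_of_tendsto_zero hy hy0 (Germ.coe_eq.1 (h1.symm.trans hp))
  have : FaithfulSMul ℂ[X] Ω := (faithfulSMul_iff_algebraMap_injective _ _).2 hinj
  let F := FractionRing ℂ[X]
  let _ : Algebra F Ω := FractionRing.liftAlgebra ℂ[X] Ω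
  have : IsScalarTower ℂ[X] F Ω := FractionRing.isScalarTower_liftAlgebra ℂ[X] Ω
  have : IsScalarTower ℂ F Ω := IsScalarTower.of_algebraMap_eq fun c => by
    rw [IsScalarTower.algebraMap_apply ℂ ℂ[X] F, ← IsScalarTower.algebraMap_apply ℂ[X] F Ω,
      ← IsScalarTower.algebraMap_apply ℂ ℂ[X] Ω]
  let W : ι → Ω := fun i => (w i : Germ (U : Filter ℕ) ℂ)
  have hWalg : ∀ i, IsIntegral F (W i) := fun i => by
    obtain ⟨P, hP, hP0⟩ := hw i
    have h1 := germ_polynomial_evalEval (U := U) y (w i) P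
    have h2 : IsAlgebraic ℂ[X] (W i) := ⟨P, hP, h1.trans (Germ.coe_eq.2 hP0)⟩
    exact ((IsFractionRing.isAlgebraic_iff ℂ[X] F Ω).1 h2).isIntegral
  let K := IntermediateField.adjoin F (Set.range W)
  have : FiniteDimensional F K := IntermediateField.finiteDimensional_adjoin (by
    rintro _ ⟨i, rfl⟩; exact hWalg i)
  have : IsScalarTower ℂ ℂ[X] K := IsScalarTower.of_algebraMap_eq fun c => Subtype.ext
    (IsScalarTower.algebraMap_apply ℂ ℂ[X] Ω c)
  obtain ⟨D, hD⟩ := exists_derivation_map_eq_self ℂ F K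
  let O : ValuationSubring K := (boundedGerms U).comap (algebraMap K Ω)
  have hOv : ∀ a : K, O.valuation a < 1 ↔ (boundedGerms U).valuation (a : Ω) < 1 := fun a => by
    by_cases ha : a = 0
    · rw [ha]; simp
    · rw [valuationSubring_valuation_lt_one_iff _ ha, valuationSubring_valuation_lt_one_iff _
        (fun h => ha (Subtype.ext h))]
      rfl
  have hconst : ∀ c : ℂ, germConst U ℂ c ∈ boundedGerms U := fun c =>
    coe_mem_boundedGerms.2 ⟨‖c‖, Eventually.of_forall fun _ => le_rfl⟩
  have key : ∀ a ∈ O, O.valuation (D a) < 1 := fun a ha =>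
    valuation_derivation_lt_one ℂ F K D hD O hconst
      (fun r hr => by
        obtain ⟨c, hc⟩ := boundedGerms_exists_residue (U := U) (a := (r : Ω)) hr
        exact ⟨c, (hOv _).2 hc⟩)
      ((hOv _).2 (by
        have : ((algebraMap ℂ[X] K X : K) : Ω) = Y := aeval_X Y
        rw [this]
        exact boundedGerms_valuation_lt_one.2 hy)) ha
  let WK : ι → K := fun i => ⟨W i, IntermediateField.subset_adjoin F _ ⟨i, rfl⟩⟩
  have hrep : ∀ i, ∃ δ : ℕ → ℂ, ((δ : Germ (U : Filter ℕ) ℂ) : Ω) = ((D (WK i) : K) : Ω) :=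
    fun i => Quot.exists_rep _
  choose δ hδ using hrep
  have hval : ∀ Q : MvPolynomial ι ℂ, ((MvPolynomial.aeval WK Q : K) : Ω) =
      ((fun k => MvPolynomial.eval (fun i => w i k) Q : ℕ → ℂ) : Germ (U : Filter ℕ) ℂ) := fun Q => by
    have h1 := MvPolynomial.hom_eval₂ Q (algebraMap ℂ K) (algebraMap K Ω) WK
    exact h1.trans (germ_mvPolynomial_eval₂ w Q)
  have hder : ∀ Q : MvPolynomial ι ℂ, ((D (MvPolynomial.aeval WK Q) : K) : Ω) =
      ((fun k => ∑ i, MvPolynomial.eval (fun i => w i k) (MvPolynomial.pderiv i Q) * δ i k :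
        ℕ → ℂ) : Germ (U : Filter ℕ) ℂ) := fun Q => by
    rw [derivation_mvPolynomial_aeval]
    have h1 := map_sum (Germ.coeRingHom (R := ℂ) (U : Filter ℕ))
      (fun i k => MvPolynomial.eval (fun i => w i k) (MvPolynomial.pderiv i Q) * δ i k)
      Finset.univ
    have h2 : (∑ i, fun k => MvPolynomial.eval (fun i => w i k) (MvPolynomial.pderiv i Q) * δ i k) =
        (fun k => ∑ i, MvPolynomial.eval (fun i => w i k) (MvPolynomial.pderiv i Q) * δ i k) := by
      ext k; simp
    rw [h2] at h1
    refine Eq.trans ?_ h1.symm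
    rw [← IntermediateField.coe_val, map_sum]
    refine Finset.sum_congr rfl fun i _ => ?_
    rw [map_mul]
    exact congrArg₂ (· * ·) (hval _) (hδ i).symm
  refine ⟨δ, fun Q hQ => ?_, fun Q hQ => ?_⟩
  · have h1 : MvPolynomial.aeval WK Q ∈ O := by
      change ((MvPolynomial.aeval WK Q : K) : Ω) ∈ boundedGerms U
      rw [hval]
      exact coe_mem_boundedGerms.2 hQ
    have h2 := (hOv _).1 (key _ h1)
    rw [hder] at h2
    exact boundedGerms_valuation_lt_one.1 h2
  · have h1 : algebraMap ℂ[X] K X * MvPolynomial.aeval WK Q = 1 := by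
      apply Subtype.ext
      have : ((algebraMap ℂ[X] K X : K) : Ω) = Y := aeval_X Y
      change ((algebraMap ℂ[X] K X : K) : Ω) * ((MvPolynomial.aeval WK Q : K) : Ω) = 1
      rw [this, hval]
      exact Germ.coe_eq.2 hQ
    have h2 := congrArg D h1
    rw [D.leibniz, hD, D.map_one_eq_zero, smul_eq_mul, smul_eq_mul] at h2
    have h3 : D (MvPolynomial.aeval WK Q) = - MvPolynomial.aeval WK Q := by
      have h4 : algebraMap ℂ[X] K X ≠ 0 := left_ne_zero_of_mul_eq_one h1
      exact mul_left_cancel₀ h4 (by linear_combination h2)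
    have h5 := congrArg (algebraMap K Ω) h3
    rw [map_neg] at h5
    have h6 := (hder Q).symm.trans (h5.trans (congrArg Neg.neg (hval Q)))
    exact Germ.coe_eq.1 h6

end BoundedGerms
end PolyInfinity

namespace PolyInfinity

section MalgrangeMTame

open MvPolynomial

/-- The velocity of polynomial expressions in algebraic functions. -/
theorem exists_velocity_comp (U : Ultrafilter ℕ) {ι ι' : Type*} [Fintype ι] [Fintype ι'] {y : ℕ → ℂ}
    (hy : Tendsto y (U : Filter ℕ) (𝓝 0)) (hy0 : ∀ᶠ k in (U : Filter ℕ), y k ≠ 0)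
    (w : ι → ℕ → ℂ)
    (hw : ∀ i, ∃ P : Polynomial (Polynomial ℂ), P ≠ 0 ∧
      ∀ᶠ k in (U : Filter ℕ), P.evalEval (y k) (w i k) = 0)
    (T : ι' → MvPolynomial ι ℂ) (w' : ι' → ℕ → ℂ) (hw' : ∀ i k, w' i k = eval (fun a => w a k) (T i)) :
    ∃ δ : ι' → ℕ → ℂ,
      (∀ Q : MvPolynomial ι' ℂ,
        (∃ C : ℝ, ∀ᶠ k in (U : Filter ℕ), ‖eval (fun i => w' i k) Q‖ ≤ C) →
        Tendsto (fun k => ∑ i, eval (fun i => w' i k) (pderiv i Q) * δ i k)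
          (U : Filter ℕ) (𝓝 0)) ∧
      ∀ Q : MvPolynomial ι' ℂ,
        (∀ᶠ k in (U : Filter ℕ), y k * eval (fun i => w' i k) Q = 1) →
        ∀ᶠ k in (U : Filter ℕ),
          ∑ i, eval (fun i => w' i k) (pderiv i Q) * δ i k = - eval (fun i => w' i k) Q := by
  obtain ⟨δ, h1, h2⟩ := exists_velocity U hy hy0 w hw
  have hev : ∀ (Q : MvPolynomial ι' ℂ) (k : ℕ), eval (fun i => w' i k) Q =
      eval (fun a => w a k) (aeval T Q) := fun Q k => by
    have h3 := hom_eval₂ Q (algebraMap ℂ (MvPolynomial ι ℂ)) (eval fun a => w a k) T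
    rw [aeval_def, h3]
    have h4 : (eval fun a => w a k).comp (algebraMap ℂ (MvPolynomial ι ℂ)) = RingHom.id ℂ := by
      ext r; simp
    rw [h4]
    simp only [hw']
    rfl
  have hder : ∀ (Q : MvPolynomial ι' ℂ) (k : ℕ),
      ∑ a, eval (fun a => w a k) (pderiv a (aeval T Q)) * δ a k =
      ∑ i, eval (fun i => w' i k) (pderiv i Q) *
        ∑ a, eval (fun a => w a k) (pderiv a (T i)) * δ a k := fun Q k => by
    simp only [derivation_mvPolynomial_aeval, map_sum, map_mul, Finset.sum_mul, Finset.mul_sum]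
    rw [Finset.sum_comm]
    refine Finset.sum_congr rfl fun i _ => Finset.sum_congr rfl fun a _ => ?_
    rw [hev]; ring
  refine ⟨fun i k => ∑ a, eval (fun a => w a k) (pderiv a (T i)) * δ a k, fun Q hQ => ?_,
    fun Q hQ => ?_⟩
  · simp only [← hder]
    simp only [hev] at hQ
    exact h1 _ hQ
  · simp only [hev Q] at hQ
    filter_upwards [h2 _ hQ] with k hk
    rw [← hder, hk, hev]

theorem exists_re_im {σ : Type*} (Q : MvPolynomial σ ℂ) :
    ∃ A B : MvPolynomial σ ℝ, ∀ x : σ → ℝ,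
      eval (fun s => (x s : ℂ)) Q = (eval x A : ℂ) + (eval x B : ℂ) * Complex.I := by
  induction Q using MvPolynomial.induction_on with
  | C a => exact ⟨C a.re, C a.im, fun x => by simp⟩
  | add p q hp hq =>
    obtain ⟨A, B, h⟩ := hp
    obtain ⟨A', B', h'⟩ := hq
    exact ⟨A + A', B + B', fun x => by simp only [map_add, h, h']; push_cast; ring⟩
  | mul_X p i hp =>
    obtain ⟨A, B, h⟩ := hp
    exact ⟨A * X i, B * X i, fun x => by simp only [map_mul, h, eval_X]; push_cast; ring⟩

/-- Curve selection for sets of real points defined by polynomials with complex coefficients. -/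
theorem exists_algebraic_selection_complex (U : Ultrafilter ℕ) {ι κ : Type*} [Finite ι] [Finite κ]
    (q : κ → MvPolynomial (Option ι) ℂ) (y : ℕ → ℝ)
    (hc : ∀ k, IsCompact {x : ι → ℝ | ∀ a, eval (fun o => ((o.elim (y k) x : ℝ) : ℂ)) (q a) = 0})
    (hne : ∀ k, ∃ x : ι → ℝ, ∀ a, eval (fun o => ((o.elim (y k) x : ℝ) : ℂ)) (q a) = 0) :
    ∃ x : ℕ → ι → ℝ,
      (∀ k a, eval (fun o => ((o.elim (y k) (x k) : ℝ) : ℂ)) (q a) = 0) ∧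
      ∀ i, ∃ P : Polynomial (Polynomial ℂ), P ≠ 0 ∧
        ∀ᶠ k in (U : Filter ℕ), P.evalEval (y k : ℂ) (x k i : ℂ) = 0 := by
  choose A B hAB using fun a => exists_re_im (q a)
  let r : κ × Bool → MvPolynomial (Option ι) ℝ := fun p => if p.2 then A p.1 else B p.1
  have hr : ∀ (x : Option ι → ℝ),
      (∀ p, eval x (r p) = 0) ↔ ∀ a, eval (fun o => (x o : ℂ)) (q a) = 0 := fun x => by
    constructor
    · intro h a
      have h1 := h (a, true)
      have h2 := h (a, false)
      simp only [r, if_true, Bool.false_eq_true, if_false] at h1 h2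
      rw [hAB, h1, h2]; simp
    · rintro h ⟨a, b⟩
      have h1 := h a
      rw [hAB] at h1
      have h2 : eval x (A a) = 0 := by simpa using congrArg Complex.re h1
      have h3 : eval x (B a) = 0 := by simpa using congrArg Complex.im h1
      cases b <;> simp [r, h2, h3]
  obtain ⟨x, hx, hP⟩ := exists_algebraic_selection U r y (fun k => by simpa only [hr] using hc k)
    (fun k => by simpa only [hr] using hne k)
  refine ⟨x, fun k => (hr _).1 (hx k), fun i => ?_⟩
  obtain ⟨P, hP0, hP⟩ := hP i
  refine ⟨P.map (Polynomial.mapRingHom Complex.ofRealHom), ?_, ?_⟩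
  · rwa [Ne, Polynomial.map_eq_zero_iff]
    exact Polynomial.map_injective _ Complex.ofRealHom.injective
  · filter_upwards [hP] with k hk
    have h1 := Polynomial.map_mapRingHom_evalEval Complex.ofRealHom P (y k) (x k i)
    rw [hk, map_zero] at h1
    exact h1

theorem eval_conj_map_conj {σ : Type*} (z : σ → ℂ) (Q : MvPolynomial σ ℂ) :
    eval (fun i => (starRingEnd ℂ) (z i)) (map (starRingEnd ℂ) Q) = (starRingEnd ℂ) (eval z Q) := by
  rw [eval_map]
  exact (eval₂_comp (starRingEnd ℂ) z Q).symm

theorem eval_aeval_mvPolynomial {σ τ : Type*} (v : τ → ℂ) (Z : σ → MvPolynomial τ ℂ)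
    (Q : MvPolynomial σ ℂ) : eval v (aeval Z Q) = eval (fun i => eval v (Z i)) Q := by
  induction Q using MvPolynomial.induction_on with
  | C a => simp
  | add p q hp hq => simp only [map_add, hp, hq]
  | mul_X p i hp => simp only [map_mul, hp, aeval_X, eval_X]

theorem grad_apply {m : ℕ} (g : MvPolynomial (Fin m) ℂ) (x : EuclideanSpace ℂ (Fin m)) (i : Fin m) :
    grad g x i = (starRingEnd ℂ) (eval (fun j => x j) (pderiv i g)) := rfl

theorem mem_milnorSet_iff {m : ℕ} (g : MvPolynomial (Fin m) ℂ) {x : EuclideanSpace ℂ (Fin m)}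
    (hx : x ≠ 0) : x ∈ milnorSet g ↔ ∀ i j, grad g x i * x j = grad g x j * x i := by
  constructor
  · rintro ⟨c, hc⟩ i j
    rw [hc]
    simp only [PiLp.smul_apply, smul_eq_mul]
    ring
  · intro h
    obtain ⟨j, hj⟩ : ∃ j, x j ≠ 0 := by
      by_contra hcon
      push Not at hcon
      exact hx (PiLp.ext hcon)
    refine ⟨grad g x j / x j, PiLp.ext fun i => ?_⟩
    rw [PiLp.smul_apply, smul_eq_mul, div_mul_eq_mul_div, eq_div_iff hj, h]

/-- The point of complex space with given real and imaginary parts. -/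
noncomputable def complexPoint {m : ℕ} (x : Option (Fin m × Bool) → ℝ) : EuclideanSpace ℂ (Fin m) :=
  WithLp.toLp 2 fun i => (x (some (i, false)) : ℂ) + x (some (i, true)) * Complex.I

/-- The coordinates of `complexPoint` as polynomials. -/
noncomputable def coordPoly {m : ℕ} (i : Fin m) : MvPolynomial (Option (Fin m × Bool)) ℂ :=
  X (some (i, false)) + X (some (i, true)) * C Complex.I

/-- The conjugate coordinates of `complexPoint` as polynomials. -/
noncomputable def conjCoordPoly {m : ℕ} (i : Fin m) : MvPolynomial (Option (Fin m × Bool)) ℂ :=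
  X (some (i, false)) - X (some (i, true)) * C Complex.I

theorem eval_coordPoly {m : ℕ} (x : Option (Fin m × Bool) → ℝ) (i : Fin m) :
    eval (fun o => (x o : ℂ)) (coordPoly i) = complexPoint x i := by
  simp [coordPoly, complexPoint]

theorem eval_conjCoordPoly {m : ℕ} (x : Option (Fin m × Bool) → ℝ) (i : Fin m) :
    eval (fun o => (x o : ℂ)) (conjCoordPoly i) = (starRingEnd ℂ) (complexPoint x i) := by
  simp [conjCoordPoly, complexPoint, sub_eq_add_neg]

/-- The equations of the set of points of `milnorSet g` of norm `y⁻¹ ^ 2` at which the modulus of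
`g` is at most `B`; the variable `none` is the parameter `y`, the variable `some none` a slack
variable. -/
noncomputable def milnorEquations {m : ℕ} (g : MvPolynomial (Fin m) ℂ) (B : ℝ) :
    (Fin m × Fin m) ⊕ Bool → MvPolynomial (Option (Option (Fin m × Bool))) ℂ
  | .inl (i, j) => rename some
      (aeval conjCoordPoly (map (starRingEnd ℂ) (pderiv i g)) * coordPoly j
        - aeval conjCoordPoly (map (starRingEnd ℂ) (pderiv j g)) * coordPoly i)
  | .inr false => X none * rename some (∑ i, coordPoly i * conjCoordPoly i) - 1
  | .inr true => rename some
      (aeval coordPoly g * aeval conjCoordPoly (map (starRingEnd ℂ) g) + X none ^ 2 - C (B ^ 2 : ℂ))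

theorem sum_mul_conj_eq {m : ℕ} (x : EuclideanSpace ℂ (Fin m)) :
    ∑ i, x i * (starRingEnd ℂ) (x i) = ((‖x‖ ^ 2 : ℝ) : ℂ) := by
  rw [EuclideanSpace.norm_sq_eq]
  push_cast
  exact Finset.sum_congr rfl fun i _ => Complex.mul_conj' _

theorem milnorEquations_iff {m : ℕ} (g : MvPolynomial (Fin m) ℂ) (B y : ℝ)
    (x : Option (Fin m × Bool) → ℝ) :
    (∀ a, eval (fun o => ((o.elim y x : ℝ) : ℂ)) (milnorEquations g B a) = 0) ↔
      complexPoint x ∈ milnorSet g ∧ y * ‖complexPoint x‖ ^ 2 = 1 ∧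
        ‖val g (complexPoint x)‖ ^ 2 + x none ^ 2 = B ^ 2 := by
  have hren : ∀ Q : MvPolynomial (Option (Fin m × Bool)) ℂ,
      eval (fun o => ((Option.elim o y x : ℝ) : ℂ)) (rename some Q) = eval (fun o => (x o : ℂ)) Q :=
    fun Q => by rw [eval_rename]; rfl
  have hconj : ∀ Q : MvPolynomial (Fin m) ℂ,
      eval (fun o => (x o : ℂ)) (aeval conjCoordPoly (map (starRingEnd ℂ) Q)) =
        (starRingEnd ℂ) (eval (fun j => complexPoint x j) Q) := fun Q => by
    rw [eval_aeval_mvPolynomial, ← eval_conj_map_conj]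
    simp only [eval_conjCoordPoly]
  have h1 : ∀ i j, eval (fun o => ((Option.elim o y x : ℝ) : ℂ)) (milnorEquations g B (.inl (i, j))) =
      grad g (complexPoint x) i * complexPoint x j - grad g (complexPoint x) j * complexPoint x i :=
    fun i j => by
      simp only [milnorEquations, hren, map_sub, map_mul, hconj, eval_coordPoly, grad_apply]
  have h2 : eval (fun o => ((Option.elim o y x : ℝ) : ℂ)) (milnorEquations g B (.inr false)) =
      ((y * ‖complexPoint x‖ ^ 2 - 1 : ℝ) : ℂ) := by
    simp only [milnorEquations, hren, map_sub, map_mul, map_sum, eval_coordPoly, eval_conjCoordPoly,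
      eval_X, map_one, sum_mul_conj_eq]
    push_cast
    rfl
  have h3 : eval (fun o => ((Option.elim o y x : ℝ) : ℂ)) (milnorEquations g B (.inr true)) =
      ((‖val g (complexPoint x)‖ ^ 2 + x none ^ 2 - B ^ 2 : ℝ) : ℂ) := by
    simp only [milnorEquations, hren, map_sub, map_add, map_mul, hconj, eval_X, map_pow, eval_C,
      eval_aeval_mvPolynomial, eval_coordPoly]
    rw [Complex.mul_conj']
    push_cast
    rfl
  constructor
  · intro h
    have e2 : y * ‖complexPoint x‖ ^ 2 - 1 = 0 := Complex.ofReal_eq_zero.1 (h2.symm.trans (h _))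
    have e3 : ‖val g (complexPoint x)‖ ^ 2 + x none ^ 2 - B ^ 2 = 0 :=
      Complex.ofReal_eq_zero.1 (h3.symm.trans (h _))
    refine ⟨(mem_milnorSet_iff g ?_).2 fun i j => sub_eq_zero.1 ((h1 i j).symm.trans (h _)),
      sub_eq_zero.1 e2, sub_eq_zero.1 e3⟩
    intro h0
    rw [h0] at e2
    norm_num at e2
  · rintro ⟨e1, e2, e3⟩ (⟨i, j⟩ | _ | _)
    · rw [h1, sub_eq_zero]
      refine (mem_milnorSet_iff g ?_).1 e1 i j
      intro h0
      rw [h0] at e2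
      norm_num at e2
    · rw [h2, e2]; simp
    · rw [h3, e3]; simp

theorem isCompact_milnorEquations {m : ℕ} (g : MvPolynomial (Fin m) ℂ) (B : ℝ) {y : ℝ}
    (hy : 0 < y) : IsCompact {x : Option (Fin m × Bool) → ℝ |
      ∀ a, eval (fun o => ((o.elim y x : ℝ) : ℂ)) (milnorEquations g B a) = 0} := by
  refine IsCompact.of_isClosed_subset
    (isCompact_univ_pi fun _ => isCompact_Icc (a := -(1 / y + 1 + |B|)) (b := 1 / y + 1 + |B|)) ?_ ?_
  · simp only [Set.ofPred_forall]
    refine isClosed_iInter fun a => isClosed_eq ?_ continuous_const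
    refine (MvPolynomial.continuous_eval _).comp (continuous_pi fun o => ?_)
    refine Complex.continuous_ofReal.comp ?_
    cases o with
    | none => exact continuous_const
    | some o => exact continuous_apply o
  · intro x hx o _
    obtain ⟨-, h2, h3⟩ := (milnorEquations_iff g B y x).1 hx
    change x o ∈ Set.Icc _ _
    rw [Set.mem_Icc, ← abs_le]
    have hy1 : 0 < 1 / y := by positivity
    cases o with
    | none =>
      have : |x none| ≤ |B| := sq_le_sq.1 (by nlinarith [sq_nonneg ‖val g (complexPoint x)‖])
      linarith
    | some p =>
      obtain ⟨i, b⟩ := p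
      have h4 : ‖complexPoint x i‖ ^ 2 ≤ ‖complexPoint x‖ ^ 2 := by
        rw [EuclideanSpace.norm_sq_eq]
        exact Finset.single_le_sum (f := fun i => ‖complexPoint x i‖ ^ 2)
          (fun i _ => sq_nonneg _) (Finset.mem_univ i)
      have h5 : ‖complexPoint x i‖ ^ 2 = x (some (i, false)) ^ 2 + x (some (i, true)) ^ 2 := by
        rw [← Complex.normSq_eq_norm_sq]
        simp [complexPoint, Complex.normSq_apply]
        ring
      have h6 : ‖complexPoint x‖ ^ 2 = 1 / y := by
        rw [eq_div_iff hy.ne', mul_comm]; exact h2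
      have h7 : x (some (i, b)) ^ 2 ≤ 1 / y := by
        cases b <;> nlinarith [sq_nonneg (x (some (i, false))), sq_nonneg (x (some (i, true)))]
      have h8 : |x (some (i, b))| ≤ 1 / y + 1 := abs_le_of_sq_le_sq (by nlinarith) (by linarith)
      linarith [abs_nonneg B]

theorem pderiv_rename_eq_zero {R σ τ : Type*} [CommRing R] {f : σ → τ} {t : τ}
    (ht : ∀ s, f s ≠ t) (Q : MvPolynomial σ R) : pderiv t (rename f Q) = 0 := by
  classical
  refine pderiv_eq_zero_of_notMem_vars fun h => ?_
  obtain ⟨s, -, hs⟩ := Finset.mem_image.1 (vars_rename f Q h)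
  exact ht s hs

theorem exists_velocity_milnorSet {m : ℕ} (g : MvPolynomial (Fin m) ℂ) (U : Ultrafilter ℕ)
    {y : ℕ → ℝ} (hy : Tendsto y (U : Filter ℕ) (𝓝 0)) (hy0 : ∀ k, 0 < y k) {B : ℝ}
    {x : ℕ → Option (Fin m × Bool) → ℝ}
    (hx : ∀ k a, eval (fun o => ((o.elim (y k) (x k) : ℝ) : ℂ)) (milnorEquations g B a) = 0)
    (halg : ∀ i, ∃ P : Polynomial (Polynomial ℂ), P ≠ 0 ∧
        ∀ᶠ k in (U : Filter ℕ), P.evalEval (y k : ℂ) (x k i : ℂ) = 0) :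
    Tendsto (fun k => ‖complexPoint (x k)‖ * ‖grad g (complexPoint (x k))‖)
      (U : Filter ℕ) (𝓝 0) := by
  let z : ℕ → EuclideanSpace ℂ (Fin m) := fun k => complexPoint (x k)
  let w' : Fin m ⊕ Fin m → ℕ → ℂ := Sum.elim (fun i k => z k i) fun i k => (starRingEnd ℂ) (z k i)
  have hyC : Tendsto (fun k => (y k : ℂ)) (U : Filter ℕ) (𝓝 0) := by
    rw [← Complex.ofReal_zero]
    exact (Complex.continuous_ofReal.tendsto 0).comp hy
  obtain ⟨δ, hδ, hδR⟩ := exists_velocity_comp U hyC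
    (Eventually.of_forall fun k => Complex.ofReal_ne_zero.2 (hy0 k).ne')
    (fun i k => (x k i : ℂ)) halg (Sum.elim coordPoly conjCoordPoly) w' (by
      rintro (i | i) k
      · exact (eval_coordPoly (x k) i).symm
      · exact (eval_conjCoordPoly (x k) i).symm)
  have hM := fun k => (milnorEquations_iff g B (y k) (x k)).1 (hx k)
  choose c hc using fun k => (hM k).1
  have hbd : ∀ k, ‖val g (z k)‖ ≤ |B| := fun k =>
    abs_norm (val g (z k)) ▸ sq_le_sq.1 (by nlinarith [(hM k).2.2, sq_nonneg (x k none)])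
  have ha := hδ (rename Sum.inl g) ⟨|B|, Eventually.of_forall fun k => by
    rw [eval_rename]; exact hbd k⟩
  have hb := hδ (rename Sum.inr (map (starRingEnd ℂ) g)) ⟨|B|, Eventually.of_forall fun k => by
    rw [eval_rename]
    have h1 := eval_conj_map_conj (fun i => z k i) g
    refine (congrArg norm h1).trans_le ?_
    rw [RCLike.norm_conj]
    exact hbd k⟩
  have hR := hδR (∑ i, X (Sum.inl i) * X (Sum.inr i)) (Eventually.of_forall fun k => by
    simp only [map_sum, map_mul, eval_X]
    have h1 := sum_mul_conj_eq (z k)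
    have h2 : (y k : ℂ) * ((‖z k‖ ^ 2 : ℝ) : ℂ) = 1 := by exact_mod_cast (hM k).2.1
    rw [← h1] at h2
    exact h2)
  have hg : ∀ k i, eval (fun j => z k j) (pderiv i g) = (starRingEnd ℂ) (c k) * (starRingEnd ℂ) (z k i) :=
    fun k i => by
      have h1 : grad g (z k) i = c k * z k i := by rw [hc k]; rfl
      rw [grad_apply] at h1
      rw [← map_mul, ← h1, Complex.conj_conj]
  have ha' : ∀ k, ∑ i, eval (fun i => w' i k) (pderiv i (rename Sum.inl g)) * δ i k =
      (starRingEnd ℂ) (c k) * ∑ i, (starRingEnd ℂ) (z k i) * δ (Sum.inl i) k := fun k => by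
    rw [Fintype.sum_sum_type, Finset.mul_sum, Finset.sum_eq_zero (s := Finset.univ)
      (f := fun i : Fin m => eval (fun i => w' i k) (pderiv (Sum.inr i) (rename Sum.inl g)) * _)
      fun i _ => by rw [pderiv_rename_eq_zero (fun _ => Sum.inl_ne_inr), map_zero, zero_mul],
      add_zero]
    refine Finset.sum_congr rfl fun i _ => ?_
    rw [pderiv_rename Sum.inl_injective, eval_rename, ← mul_assoc, ← hg]
    rfl
  have hb' : ∀ k, ∑ i, eval (fun i => w' i k)
      (pderiv i (rename Sum.inr (map (starRingEnd ℂ) g))) * δ i k =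
      c k * ∑ i, z k i * δ (Sum.inr i) k := fun k => by
    rw [Fintype.sum_sum_type, Finset.mul_sum, Finset.sum_eq_zero (s := Finset.univ)
      (f := fun i : Fin m => eval (fun i => w' i k)
        (pderiv (Sum.inl i) (rename Sum.inr (map (starRingEnd ℂ) g))) * _)
      fun i _ => by rw [pderiv_rename_eq_zero (fun _ => Sum.inr_ne_inl), map_zero, zero_mul],
      zero_add]
    refine Finset.sum_congr rfl fun i _ => ?_
    rw [pderiv_rename Sum.inr_injective, eval_rename, pderiv_map, ← mul_assoc]
    congr 1
    refine (eval_conj_map_conj (fun i => z k i) (pderiv i g)).trans ?_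
    rw [hg, map_mul, Complex.conj_conj, Complex.conj_conj]
  have hR' : ∀ k, ∑ i, eval (fun i => w' i k)
      (pderiv i (∑ i, X (Sum.inl i) * X (Sum.inr i))) * δ i k =
      ∑ i, (starRingEnd ℂ) (z k i) * δ (Sum.inl i) k + ∑ i, z k i * δ (Sum.inr i) k := fun k => by
    rw [Fintype.sum_sum_type]
    congr 1 <;> refine Finset.sum_congr rfl fun i _ => ?_ <;> congr 1 <;>
      simp [pderiv_X, Pi.single_apply, w']
  simp only [ha'] at ha
  simp only [hb'] at hb
  have hlim := ha.norm.add hb.norm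
  rw [norm_zero, add_zero] at hlim
  refine squeeze_zero' (Eventually.of_forall fun k => by positivity) ?_ hlim
  filter_upwards [hR] with k hk
  rw [hR'] at hk
  simp only [map_sum, map_mul, eval_X] at hk
  have hk' : ∑ i, (starRingEnd ℂ) (z k i) * δ (Sum.inl i) k + ∑ i, z k i * δ (Sum.inr i) k =
      - ((‖z k‖ ^ 2 : ℝ) : ℂ) := by rw [← sum_mul_conj_eq]; exact hk
  set a := ∑ i, (starRingEnd ℂ) (z k i) * δ (Sum.inl i) k
  set b := ∑ i, z k i * δ (Sum.inr i) k
  have h1 : ‖z k‖ ^ 2 ≤ ‖a‖ + ‖b‖ := by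
    calc ‖z k‖ ^ 2 = ‖a + b‖ := by rw [hk', norm_neg, Complex.norm_real, Real.norm_of_nonneg (sq_nonneg _)]
      _ ≤ _ := norm_add_le _ _
  have h2 : ‖grad g (z k)‖ = ‖c k‖ * ‖z k‖ := by rw [hc k, norm_smul]
  change ‖z k‖ * ‖grad g (z k)‖ ≤ _
  rw [h2, norm_mul, norm_mul, RCLike.norm_conj]
  nlinarith [mul_le_mul_of_nonneg_left h1 (norm_nonneg (c k))]

/-- Malgrange's condition at every value implies M-tameness. -/
theorem mTame_of_malgrange {m : ℕ} (g : MvPolynomial (Fin m) ℂ) (hg : ∀ t₀, Malgrange g t₀) :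
    MTame g := by
  intro z hz hnorm
  by_contra hcon
  rw [tendsto_atTop] at hcon
  push Not at hcon
  obtain ⟨B, hB⟩ := hcon
  obtain ⟨φ, hφ, hφB⟩ := extraction_of_frequently_atTop
    (hB.and_eventually (hnorm.eventually_ge_atTop 1))
  let y : ℕ → ℝ := fun k => 1 / ‖z (φ k)‖ ^ 2
  have hpos : ∀ k, 0 < ‖z (φ k)‖ := fun k => lt_of_lt_of_le one_pos (hφB k).2
  have hy0 : ∀ k, 0 < y k := fun k => by have := hpos k; positivity
  let U := hyperfilter ℕ
  have hy : Tendsto y (U : Filter ℕ) (𝓝 0) := by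
    have h1 : Tendsto (fun k => ‖z (φ k)‖ ^ 2) atTop atTop :=
      (tendsto_pow_atTop two_ne_zero).comp (hnorm.comp hφ.tendsto_atTop)
    have h2 := (tendsto_const_nhds (x := (1 : ℝ))).div_atTop h1
    exact h2.mono_left Nat.hyperfilter_le_atTop
  obtain ⟨x, hx, halg⟩ := exists_algebraic_selection_complex U (milnorEquations g B) y
    (fun k => isCompact_milnorEquations g B (hy0 k)) (fun k => by
      let x : Option (Fin m × Bool) → ℝ := fun o => o.elim (√(B ^ 2 - ‖val g (z (φ k))‖ ^ 2))
        fun p => if p.2 then (z (φ k) p.1).im else (z (φ k) p.1).re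
      have hxz : complexPoint x = z (φ k) := PiLp.ext fun i => by
        simp [complexPoint, x, Complex.re_add_im]
      refine ⟨x, (milnorEquations_iff g B (y k) x).2 ?_⟩
      rw [hxz]
      refine ⟨hz _, div_mul_cancel₀ _ (pow_ne_zero 2 (hpos k).ne'), ?_⟩
      change _ + √(B ^ 2 - ‖val g (z (φ k))‖ ^ 2) ^ 2 = _
      rw [Real.sq_sqrt (by nlinarith [(hφB k).1, norm_nonneg (val g (z (φ k)))])]
      ring)
  have hlim := exists_velocity_milnorSet g U hy hy0 hx halg
  have hM := fun k => (milnorEquations_iff g B (y k) (x k)).1 (hx k)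
  have hbd : ∀ k, ‖val g (complexPoint (x k))‖ ≤ |B| := fun k =>
    abs_norm (val g (complexPoint (x k))) ▸ sq_le_sq.1
      (by nlinarith [(hM k).2.2, sq_nonneg (x k none)])
  obtain ⟨t, -, ht⟩ := (isCompact_closedBall (0 : ℂ) |B|).ultrafilter_le_nhds'
    (U.map fun k => val g (complexPoint (x k)))
    (Eventually.of_forall fun k => by simpa using hbd k : ∀ᶠ k in (U : Filter ℕ),
      val g (complexPoint (x k)) ∈ Metric.closedBall (0 : ℂ) |B|)
  have ht' : Tendsto (fun k => val g (complexPoint (x k))) (U : Filter ℕ) (𝓝 t) := ht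
  obtain ⟨δ, hδ, R, ε, hε, h⟩ := hg t
  have hnormx : ∀ᶠ k in (U : Filter ℕ), R ≤ ‖complexPoint (x k)‖ := by
    have h1 : ∀ᶠ k in (U : Filter ℕ), y k < 1 / (|R| + 1) ^ 2 := hy.eventually_lt_const (by positivity)
    filter_upwards [h1] with k hk
    have h2 : ‖complexPoint (x k)‖ ^ 2 = 1 / y k := by
      rw [eq_div_iff (hy0 k).ne', mul_comm]; exact (hM k).2.1
    have h3 : (|R| + 1) ^ 2 < 1 / y k := by
      rw [lt_div_iff₀ (hy0 k), mul_comm, ← lt_div_iff₀ (by positivity)]; exact hk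
    have h4 : |R| + 1 < ‖complexPoint (x k)‖ :=
      lt_of_pow_lt_pow_left₀ 2 (norm_nonneg _) (by rw [h2]; exact h3)
    linarith [le_abs_self R]
  have hval : ∀ᶠ k in (U : Filter ℕ), ‖val g (complexPoint (x k)) - t‖ < ε := by
    filter_upwards [Metric.tendsto_nhds.1 ht' ε hε] with k hk
    rwa [← dist_eq_norm]
  obtain ⟨k, h1, h2, h3⟩ := (hnormx.and (hval.and (hlim.eventually_lt_const hδ))).exists
  exact absurd (h _ h1 h2) (not_le.2 h3)

/-- Quasitame polynomials satisfy Malgrange's condition at every value. -/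
theorem malgrange_of_quasitame {m : ℕ} (g : MvPolynomial (Fin m) ℂ) (hg : Quasitame g) (t₀ : ℂ) :
    Malgrange g t₀ := by
  by_contra hcon
  unfold Malgrange at hcon
  push Not at hcon
  choose z hz1 hz2 hz3 using fun k : ℕ => hcon (1 / ((k : ℝ) + 1)) (by positivity) ((k : ℝ) + 1)
    (1 / ((k : ℝ) + 1)) (by positivity)
  have hinv : Tendsto (fun k : ℕ => 1 / ((k : ℝ) + 1)) atTop (𝓝 0) :=
    tendsto_one_div_add_atTop_nhds_zero_nat
  have hnorm : Tendsto (fun k => ‖z k‖) atTop atTop :=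
    tendsto_atTop_mono hz1 (tendsto_atTop_add_const_right _ _ tendsto_natCast_atTop_atTop)
  have hprod : Tendsto (fun k => ‖z k‖ * ‖grad g (z k)‖) atTop (𝓝 0) :=
    squeeze_zero (fun k => by positivity) (fun k => (hz3 k).le) hinv
  have hgrad : Tendsto (fun k => grad g (z k)) atTop (𝓝 0) := by
    rw [tendsto_zero_iff_norm_tendsto_zero]
    refine squeeze_zero (fun k => norm_nonneg _) (fun k => ?_) hprod
    have : 1 ≤ ‖z k‖ := le_trans (by linarith [(Nat.cast_nonneg k : (0 : ℝ) ≤ k)]) (hz1 k)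
    nlinarith [norm_nonneg (grad g (z k))]
  have h := hg z hnorm hgrad
  have hb : ∀ k, ‖val g (z k) - inner ℂ (grad g (z k)) (z k)‖ ≤ ‖t₀‖ + 2 := fun k => by
    have h1 : 1 / ((k : ℝ) + 1) ≤ 1 := by
      rw [div_le_one (by positivity)]; linarith [(Nat.cast_nonneg k : (0 : ℝ) ≤ k)]
    have h2 := norm_inner_le_norm (𝕜 := ℂ) (grad g (z k)) (z k)
    have h3 : ‖val g (z k)‖ ≤ ‖t₀‖ + ‖val g (z k) - t₀‖ := norm_le_norm_add_norm_sub' _ _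
    have h4 := norm_sub_le (val g (z k)) (inner ℂ (grad g (z k)) (z k))
    linarith [hz2 k, hz3 k, mul_comm ‖z k‖ ‖grad g (z k)‖]
  obtain ⟨k, hk⟩ := (h.eventually_gt_atTop (‖t₀‖ + 2)).exists
  exact absurd (hb k) (not_le.2 hk)

end MalgrangeMTame
end PolyInfinity

namespace PolyInfinity

section ScalarEstimates

/-- The partial derivative of `f_{n,q}` in the first variable as a function of `u = x ^ n * y ^ q`
is bounded away from zero for small `u`. -/
theorem half_le_norm_of_norm_le {n : ℕ} {u : ℂ} (hu : ‖u‖ ≤ 1 / (20 * (n + 1))) :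
    1 / 2 ≤ ‖1 - 3 * (2 * n + 1) * u ^ 2 + 2 * (3 * n + 1) * u ^ 3‖ := by
  have hn : (0 : ℝ) ≤ n := Nat.cast_nonneg n
  have h0 := norm_nonneg u
  have hu1 : ‖u‖ * (20 * (n + 1)) ≤ 1 := (le_div_iff₀ (by positivity)).1 hu
  have h1 : ‖u‖ ≤ 1 / 20 := by nlinarith
  have e : (1 : ℂ) = (1 - 3 * (2 * n + 1) * u ^ 2 + 2 * (3 * n + 1) * u ^ 3)
      + (3 * (2 * n + 1) * u ^ 2 - 2 * (3 * n + 1) * u ^ 3) := by ring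
  have h2 := norm_add_le (1 - 3 * (2 * n + 1) * u ^ 2 + 2 * (3 * n + 1) * u ^ 3)
      (3 * (2 * n + 1) * u ^ 2 - 2 * (3 * n + 1) * u ^ 3)
  rw [← e, norm_one] at h2
  have h3 := norm_sub_le (3 * (2 * n + 1) * u ^ 2) (2 * (3 * n + 1) * u ^ 3)
  have c1 : ‖(3 * (2 * n + 1) : ℂ)‖ = 3 * (2 * n + 1) := by
    rw [show (3 * (2 * n + 1) : ℂ) = ((3 * (2 * n + 1) : ℝ) : ℂ) by push_cast; ring,
      Complex.norm_real, Real.norm_of_nonneg (by positivity)]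
  have c2 : ‖(2 * (3 * n + 1) : ℂ)‖ = 2 * (3 * n + 1) := by
    rw [show (2 * (3 * n + 1) : ℂ) = ((2 * (3 * n + 1) : ℝ) : ℂ) by push_cast; ring,
      Complex.norm_real, Real.norm_of_nonneg (by positivity)]
  rw [norm_mul (3 * (2 * n + 1) : ℂ), norm_mul (2 * (3 * n + 1) : ℂ), c1, c2, norm_pow, norm_pow] at h3
  have h4 : 3 * (2 * n + 1) * ‖u‖ ^ 2 ≤ 6 / 20 * ‖u‖ := by nlinarith
  have h5 : 2 * (3 * n + 1) * ‖u‖ ^ 3 ≤ 6 / 20 * ‖u‖ ^ 2 := by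
    have : 2 * (3 * n + 1) * ‖u‖ ≤ 6 / 20 := by nlinarith
    nlinarith [mul_le_mul_of_nonneg_right this (sq_nonneg ‖u‖)]
  nlinarith

theorem norm_pow_mul_pow_le {n q : ℕ} (hn : 1 ≤ n) (hq : n ≤ q) {x y : ℂ} {δ : ℝ} (hδ : δ ≤ 1)
    (hxy : ‖x‖ * ‖y‖ ≤ δ) (hy : ‖y‖ ≤ 1) : ‖x ^ n * y ^ q‖ ≤ δ := by
  obtain ⟨r, rfl⟩ := Nat.exists_eq_add_of_le hq
  have h0 : 0 ≤ ‖x‖ * ‖y‖ := by positivity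
  rw [pow_add, ← mul_assoc, ← mul_pow, norm_mul, norm_pow, norm_pow, norm_mul]
  calc (‖x‖ * ‖y‖) ^ n * ‖y‖ ^ r ≤ (‖x‖ * ‖y‖) ^ n * 1 :=
        mul_le_mul_of_nonneg_left (pow_le_one₀ (norm_nonneg _) hy) (by positivity)
    _ ≤ ‖x‖ * ‖y‖ := by
        rw [mul_one]; exact pow_le_of_le_one h0 (hxy.trans hδ) (by omega)
    _ ≤ δ := hxy

/-- A point with `grad = lam • x` at which `f_{n,q}`, up to a sum of squares in additional
variables, is bounded by `B`. The number `W` is the sum of the squared moduli of the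
additional variables. -/
structure MilnorData (n q : ℕ) (B : ℝ) (x y z μ S : ℂ) (W : ℝ) : Prop where
  W_nonneg : 0 ≤ W
  eq_x : 1 - 3 * (2 * n + 1) * (x ^ n * y ^ q) ^ 2 + 2 * (3 * n + 1) * (x ^ n * y ^ q) ^ 3 =
    μ * (starRingEnd ℂ) x
  eq_y : 6 * q * x * ((x ^ n * y ^ q) ^ 3 - (x ^ n * y ^ q) ^ 2) + y * z = μ * (‖y‖ ^ 2 : ℝ)
  eq_z : y = μ * (starRingEnd ℂ) z
  eq_S : S = μ * (W / 2 : ℝ)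
  bound : ‖x * (1 - 3 * (x ^ n * y ^ q) ^ 2 + 2 * (x ^ n * y ^ q) ^ 3) + y * z + S‖ ≤ B

namespace MilnorData

variable {n q : ℕ} {B : ℝ} {x y z μ S : ℂ} {W : ℝ}

theorem mul_x (h : MilnorData n q B x y z μ S W) :
    x * (1 - 3 * (2 * n + 1) * (x ^ n * y ^ q) ^ 2 + 2 * (3 * n + 1) * (x ^ n * y ^ q) ^ 3) =
      μ * (‖x‖ ^ 2 : ℝ) := by
  rw [h.eq_x]
  push_cast
  rw [← Complex.mul_conj']; ring

theorem mul_z (h : MilnorData n q B x y z μ S W) : y * z = μ * (‖z‖ ^ 2 : ℝ) := by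
  push_cast
  rw [← Complex.mul_conj']
  nth_rw 1 [h.eq_z]
  ring

theorem norm_y_sq (h : MilnorData n q B x y z μ S W) : ‖y‖ ^ 2 = ‖μ‖ ^ 2 * ‖z‖ ^ 2 := by
  nth_rw 1 [h.eq_z]
  rw [norm_mul, RCLike.norm_conj, mul_pow]

theorem norm_eq (h : MilnorData n q B x y z μ S W) :
    ‖1 - 3 * (2 * n + 1) * (x ^ n * y ^ q) ^ 2 + 2 * (3 * n + 1) * (x ^ n * y ^ q) ^ 3‖ ^ 2 =
      ‖μ‖ ^ 2 * ‖x‖ ^ 2 := by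
  rw [h.eq_x, norm_mul, RCLike.norm_conj, mul_pow]

theorem ne_zero (hq : 1 ≤ q) (h : MilnorData n q B x y z μ S W) : μ ≠ 0 := by
  rintro rfl
  have hy : y = 0 := by simpa using h.eq_z
  have h1 := h.eq_x
  rw [hy, zero_pow (by omega : q ≠ 0)] at h1
  simp at h1

theorem six_mul (h : MilnorData n q B x y z μ S W) :
    6 * q * x * ((x ^ n * y ^ q) ^ 3 - (x ^ n * y ^ q) ^ 2) =
      μ * (‖y‖ ^ 2 - ‖z‖ ^ 2 : ℝ) := by
  have h1 := h.eq_y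
  rw [h.mul_z] at h1
  push_cast at h1 ⊢
  linear_combination h1

theorem value_bound (h : MilnorData n q B x y z μ S W) :
    ‖μ‖ * |q * ‖x‖ ^ 2 + q * ‖z‖ ^ 2 + q * W / 2 - n * (‖y‖ ^ 2 - ‖z‖ ^ 2)| ≤ q * B := by
  have h1 : (q : ℂ) * (x * (1 - 3 * (x ^ n * y ^ q) ^ 2 + 2 * (x ^ n * y ^ q) ^ 3) + y * z + S) =
      μ * (q * ‖x‖ ^ 2 + q * ‖z‖ ^ 2 + q * W / 2 - n * (‖y‖ ^ 2 - ‖z‖ ^ 2) : ℝ) := by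
    have e1 := h.mul_x
    have e2 := h.six_mul
    rw [h.mul_z, h.eq_S]
    push_cast at e1 e2 ⊢
    linear_combination (q : ℂ) * e1 - (n : ℂ) * e2
  have h2 := congrArg norm h1
  rw [norm_mul, norm_mul, Complex.norm_real, Complex.norm_natCast, Real.norm_eq_abs] at h2
  rw [← h2]
  exact mul_le_mul_of_nonneg_left h.bound (Nat.cast_nonneg q)

theorem one_lt_norm_of_lt (h : MilnorData n q B x y z μ S W) (hyz : ‖z‖ ^ 2 < ‖y‖ ^ 2) :
    1 < ‖μ‖ := by
  by_contra hcon
  have h2 : ‖μ‖ ^ 2 ≤ 1 := pow_le_one₀ (norm_nonneg _) (not_lt.1 hcon)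
  have h3 := mul_le_mul_of_nonneg_right h2 (sq_nonneg ‖z‖)
  rw [← h.norm_y_sq] at h3
  linarith

theorem abs_value_le_of_lt (h : MilnorData n q B x y z μ S W) (hyz : ‖z‖ ^ 2 < ‖y‖ ^ 2) :
    |q * ‖x‖ ^ 2 + q * ‖z‖ ^ 2 + q * W / 2 - n * (‖y‖ ^ 2 - ‖z‖ ^ 2)| ≤ q * B :=
  (le_mul_of_one_le_left (abs_nonneg _) (h.one_lt_norm_of_lt hyz).le).trans h.value_bound

theorem sum_le_of_lt (hq : 1 ≤ q) (h : MilnorData n q B x y z μ S W) (hyz : ‖z‖ ^ 2 < ‖y‖ ^ 2) :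
    ‖x‖ ^ 2 + ‖y‖ ^ 2 + ‖z‖ ^ 2 + W ≤ (2 * n + 1) * (‖y‖ ^ 2 - ‖z‖ ^ 2) + 2 * q * B := by
  have hq' : (1 : ℝ) ≤ q := by exact_mod_cast hq
  have h1 := (abs_le.1 (h.abs_value_le_of_lt hyz)).2
  have h2 : 0 ≤ ‖x‖ ^ 2 + ‖z‖ ^ 2 + W / 2 := by have := h.W_nonneg; positivity
  have h3 := le_mul_of_one_le_left h2 hq'
  linarith [sq_nonneg ‖x‖]

/-- The two equations obtained from `MilnorData` after eliminating `x` bound `x ^ n * y ^ q`. -/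
theorem norm_le_two_of_lt (hq : 1 ≤ q) (h : MilnorData n q B x y z μ S W)
    (hY : 6 * q * B < ‖y‖ ^ 2 - ‖z‖ ^ 2) (hyz : ‖z‖ ^ 2 < ‖y‖ ^ 2) : ‖x ^ n * y ^ q‖ ≤ 2 := by
  have hW := h.W_nonneg
  have he1 := (abs_le.1 (h.abs_value_le_of_lt hyz)).2
  have hμ := h.one_lt_norm_of_lt hyz
  have hYpos : 0 < ‖y‖ ^ 2 - ‖z‖ ^ 2 := sub_pos.2 hyz
  have e3 := h.mul_x
  have e4 := h.six_mul
  generalize x ^ n * y ^ q = u at e3 e4 ⊢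
  generalize ‖y‖ ^ 2 - ‖z‖ ^ 2 = Y at *
  have e1 : 6 * q * (x * (1 - u)) * u ^ 2 = - (μ * (Y : ℝ)) := by
    rw [← e4]; ring
  obtain ⟨e, he⟩ : ∃ e : ℝ, e = q * ‖x‖ ^ 2 + q * ‖z‖ ^ 2 + q * W / 2 - n * Y := ⟨_, rfl⟩
  rw [← he] at he1
  have e2 : 6 * q * (x * (1 - u)) * (1 + u) =
      μ * (6 * e - 6 * q * ‖z‖ ^ 2 - 3 * q * W - 2 * Y : ℝ) := by
    rw [he]
    push_cast at e1 e3 ⊢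
    linear_combination (6 * q : ℂ) * e3 + (6 * n + 2 : ℂ) * e1
  have n1 := congrArg norm e1
  have n2 := congrArg norm e2
  rw [norm_neg, norm_mul, norm_mul μ, Complex.norm_real, Real.norm_of_nonneg hYpos.le] at n1
  rw [norm_mul, norm_mul μ, Complex.norm_real, Real.norm_eq_abs] at n2
  have h3 : Y ≤ |6 * e - 6 * q * ‖z‖ ^ 2 - 3 * q * W - 2 * Y| := by
    have h31 : 0 ≤ q * ‖z‖ ^ 2 := by positivity
    have h32 : 0 ≤ q * W := by positivity
    rw [le_abs]; right
    linarith
  have h4 : ‖(6 * q * (x * (1 - u)) : ℂ)‖ * ‖u ^ 2‖ ≤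
      ‖(6 * q * (x * (1 - u)) : ℂ)‖ * ‖1 + u‖ := by
    rw [n1, n2]; exact mul_le_mul_of_nonneg_left h3 (norm_nonneg _)
  have hApos : 0 < ‖(6 * q * (x * (1 - u)) : ℂ)‖ := by
    refine (norm_nonneg _).lt_of_ne fun h0 => ?_
    rw [← h0, zero_mul] at n1
    exact (mul_pos (zero_lt_one.trans hμ) hYpos).ne n1
  have h5 : ‖u‖ ^ 2 ≤ 1 + ‖u‖ := by
    have := le_of_mul_le_mul_left h4 hApos
    rw [norm_pow] at this
    exact this.trans ((norm_add_le _ _).trans (by rw [norm_one]))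
  nlinarith [norm_nonneg u]

/-- If `‖z‖ < ‖y‖` then the point lies in a bounded set. -/
theorem bounded_of_lt (hn : 1 ≤ n) (hq : 1 ≤ q) (hB : 0 ≤ B) (h : MilnorData n q B x y z μ S W)
    (hyz : ‖z‖ ^ 2 < ‖y‖ ^ 2) :
    ‖x‖ ^ 2 + ‖y‖ ^ 2 + ‖z‖ ^ 2 + W ≤ (2 * n + 1) * (1 + 6 * q * B + 144 * q) + 2 * q * B := by
  refine (h.sum_le_of_lt hq hyz).trans (add_le_add_left (mul_le_mul_of_nonneg_left ?_
    (by positivity)) _)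
  by_contra hcon
  push Not at hcon
  have hqB : 0 ≤ 6 * q * B := by positivity
  have hq0 : (0 : ℝ) ≤ q := by positivity
  have hz0 := sq_nonneg ‖z‖
  have h6 := h.norm_le_two_of_lt hq (by linarith) hyz
  have hy1 : 1 ≤ ‖y‖ := by
    by_contra hy
    have := pow_le_one₀ (n := 2) (norm_nonneg y) (not_le.1 hy).le
    linarith
  have hx2 : ‖x‖ ≤ 2 := by
    by_contra hx
    push Not at hx
    have h7 : ‖x‖ ≤ ‖x‖ ^ n := le_self_pow₀ (by linarith) (by omega)
    have h8 : 1 ≤ ‖y‖ ^ q := one_le_pow₀ hy1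
    rw [norm_mul, norm_pow, norm_pow] at h6
    have h9 := le_mul_of_one_le_right (by positivity : 0 ≤ ‖x‖ ^ n) h8
    linarith
  have hμ := h.one_lt_norm_of_lt hyz
  have n1 := congrArg norm h.six_mul
  generalize x ^ n * y ^ q = u at n1 h6
  have h9 : ‖u - 1‖ ≤ 3 := (norm_sub_le _ _).trans (by rw [norm_one]; linarith)
  rw [show (6 * q * x * (u ^ 3 - u ^ 2) : ℂ) = (6 * q : ℝ) * (x * (u ^ 2 * (u - 1))) by
      push_cast; ring, norm_mul, norm_mul, norm_mul, norm_mul, Complex.norm_real,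
    Complex.norm_real, norm_pow, Real.norm_of_nonneg (by positivity),
    Real.norm_of_nonneg (sub_pos.2 hyz).le] at n1
  have h10 : ‖x‖ * (‖u‖ ^ 2 * ‖u - 1‖) ≤ 2 * (2 ^ 2 * 3) := by gcongr
  have h11 := mul_le_mul_of_nonneg_left h10 (by positivity : (0 : ℝ) ≤ 6 * q)
  have h12 := le_mul_of_one_le_left (sub_pos.2 hyz).le hμ.le
  linarith

/-- There are no points with `‖y‖ ≤ ‖z‖` for which `x ^ n * y ^ q` is close to `1`. -/
theorem false_of_near_one (hn : 1 ≤ n) (hq : 1 ≤ q) (h : MilnorData n q B x y z μ S W)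
    (hyz : ‖y‖ ^ 2 ≤ ‖z‖ ^ 2) (hx : x ≠ 0) (hu : ‖x ^ n * y ^ q - 1‖ ≤ 1 / 10) : False := by
  have hn' : (1 : ℝ) ≤ n := by exact_mod_cast hn
  have hq' : (1 : ℝ) ≤ q := by exact_mod_cast hq
  set u := x ^ n * y ^ q with hudef
  have e1 := h.mul_x
  have e2 := h.six_mul
  rw [← hudef] at e1 e2
  have e3 : 6 * q * u ^ 2 * (‖x‖ ^ 2 : ℝ) =
      (‖z‖ ^ 2 - ‖y‖ ^ 2 : ℝ) * (1 + u - (6 * n + 2) * u ^ 2) := by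
    refine mul_left_cancel₀ (h.ne_zero hq) ?_
    push_cast at e1 e2 ⊢
    linear_combination (-6 * q * u ^ 2 : ℂ) * e1 + (- (1 + u - (6 * n + 2) * u ^ 2) : ℂ) * e2
  have e4 := congrArg Complex.re e3
  obtain ⟨h1, h2⟩ := abs_le.1 ((Complex.abs_re_le_norm (u - 1)).trans hu)
  obtain ⟨h3, h4⟩ := abs_le.1 ((Complex.abs_im_le_norm (u - 1)).trans hu)
  simp only [Complex.sub_re, Complex.one_re, Complex.sub_im, Complex.one_im, sub_zero] at h1 h2 h3 h4
  have hre : (u ^ 2).re = u.re ^ 2 - u.im ^ 2 := by rw [sq, Complex.mul_re]; ring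
  have hpos : 3 / 4 ≤ (u ^ 2).re := by rw [hre]; nlinarith
  have e5 : (6 * q * u ^ 2 * (‖x‖ ^ 2 : ℝ) : ℂ).re = 6 * q * (u ^ 2).re * ‖x‖ ^ 2 := by
    rw [Complex.re_mul_ofReal, show (6 * q * u ^ 2 : ℂ) = ((6 * q : ℝ) : ℂ) * u ^ 2 by push_cast; ring,
      Complex.re_ofReal_mul]
  have e6 : (((‖z‖ ^ 2 - ‖y‖ ^ 2 : ℝ) : ℂ) * (1 + u - (6 * n + 2) * u ^ 2)).re =
      (‖z‖ ^ 2 - ‖y‖ ^ 2) * (1 + u.re - (6 * n + 2) * (u ^ 2).re) := by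
    rw [Complex.re_ofReal_mul, show (6 * n + 2 : ℂ) = ((6 * n + 2 : ℝ) : ℂ) by push_cast; ring,
      Complex.sub_re, Complex.re_ofReal_mul, Complex.add_re, Complex.one_re]
  rw [e5, e6] at e4
  have hxpos : 0 < ‖x‖ ^ 2 := by have := norm_pos_iff.2 hx; positivity
  have h5 : 0 < 6 * q * (u ^ 2).re * ‖x‖ ^ 2 := by positivity
  have h6 : 1 + u.re - (6 * n + 2) * (u ^ 2).re ≤ 0 := by nlinarith
  nlinarith [mul_nonneg (sub_nonneg.2 hyz) (neg_nonneg.2 h6)]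

end MilnorData

/-- The points described by `MilnorData` form a bounded set. -/
theorem exists_milnorData_bound {n q : ℕ} (hn : 1 ≤ n) (hq : 1 ≤ q) {B : ℝ} (hB : 0 ≤ B) :
    ∃ R : ℝ, ∀ (x y z μ S : ℂ) (W : ℝ), MilnorData n q B x y z μ S W →
      ‖x‖ ^ 2 + ‖y‖ ^ 2 + ‖z‖ ^ 2 + W ≤ R := by
  have hn' : (1 : ℝ) ≤ n := by exact_mod_cast hn
  have hq' : (1 : ℝ) ≤ q := by exact_mod_cast hq
  obtain ⟨η, hηdef⟩ : ∃ η : ℝ, η = 1 / (20 * (n + 1)) := ⟨_, rfl⟩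
  have hη : 0 < η := by rw [hηdef]; positivity
  have hη1 : η ≤ 1 := by
    rw [hηdef, div_le_one (by positivity)]; linarith
  obtain ⟨X₀, hX₀, hX₀η⟩ : ∃ X₀ : ℝ, 1 ≤ X₀ ∧ 10 * B < X₀ * η ^ 2 := by
    refine ⟨10 * B / η ^ 2 + 1, le_add_of_nonneg_left (by positivity), ?_⟩
    rw [add_mul, div_mul_cancel₀ _ (by positivity)]
    have : 0 < η ^ 2 := by positivity
    linarith
  have hX₀n : 1 ≤ X₀ ^ n := one_le_pow₀ hX₀
  obtain ⟨ε, hε, hεX⟩ : ∃ ε : ℝ, 0 < ε ∧ X₀ ^ n * ε = η / 4 :=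
    ⟨η / 4 / X₀ ^ n, by positivity, mul_div_cancel₀ _ (by positivity)⟩
  have hε4 : ε ≤ 1 / 4 := by
    have := le_mul_of_one_le_left hε.le hX₀n
    linarith
  refine ⟨max ((2 * n + 1) * (1 + 6 * q * B + 144 * q) + 2 * q * B) (4 * B ^ 2 / ε ^ 2),
    fun x y z μ S W h => ?_⟩
  rcases lt_or_ge (‖z‖ ^ 2) (‖y‖ ^ 2) with hyz | hyz
  · exact (h.bounded_of_lt hn hq hB hyz).trans (le_max_left _ _)
  refine le_trans ?_ (le_max_right _ _)
  by_contra hcon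
  push Not at hcon
  have hW := h.W_nonneg
  have hx0 := sq_nonneg ‖x‖
  have hz0 := sq_nonneg ‖z‖
  obtain ⟨T, hT⟩ : ∃ T : ℝ, T = ‖x‖ ^ 2 + ‖y‖ ^ 2 + ‖z‖ ^ 2 + W := ⟨_, rfl⟩
  rw [← hT] at hcon
  have hTpos : 0 < T := lt_of_le_of_lt (by positivity) hcon
  have hT2 : 4 * B ^ 2 ≤ ε ^ 2 * T := by
    rw [div_lt_iff₀ (by positivity)] at hcon; linarith
  have hn0 : 0 ≤ n * (‖z‖ ^ 2 - ‖y‖ ^ 2) := mul_nonneg (by linarith) (sub_nonneg.2 hyz)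
  have hv1 : q * (‖x‖ ^ 2 + ‖z‖ ^ 2 + W / 2) ≤
      |q * ‖x‖ ^ 2 + q * ‖z‖ ^ 2 + q * W / 2 - n * (‖y‖ ^ 2 - ‖z‖ ^ 2)| :=
    le_trans (by linarith) (le_abs_self _)
  have hv2 : ‖μ‖ * (‖x‖ ^ 2 + ‖z‖ ^ 2 + W / 2) ≤ B := by
    have h1 := (mul_le_mul_of_nonneg_left hv1 (norm_nonneg μ)).trans h.value_bound
    have h2 : (q : ℝ) * (‖μ‖ * (‖x‖ ^ 2 + ‖z‖ ^ 2 + W / 2)) ≤ q * B := by linarith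
    exact le_of_mul_le_mul_left h2 (by linarith)
  have hμT : ‖μ‖ * T ≤ 2 * B := by
    have h1 : T ≤ 2 * (‖x‖ ^ 2 + ‖z‖ ^ 2 + W / 2) := by linarith
    have h2 := mul_le_mul_of_nonneg_left h1 (norm_nonneg μ)
    linarith
  have hsmall : ‖μ‖ ^ 2 * T ≤ ε ^ 2 := by
    have h1 : (‖μ‖ * T) ^ 2 ≤ (2 * B) ^ 2 := pow_le_pow_left₀ (by positivity) hμT 2
    have h2 : ‖μ‖ ^ 2 * T * T ≤ ε ^ 2 * T := by
      rw [mul_pow, mul_pow] at h1; linarith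
    exact le_of_mul_le_mul_right h2 hTpos
  have hp : ‖1 - 3 * (2 * n + 1) * (x ^ n * y ^ q) ^ 2 +
      2 * (3 * n + 1) * (x ^ n * y ^ q) ^ 3‖ ≤ ε := by
    refine (sq_le_sq₀ (norm_nonneg _) hε.le).1 (h.norm_eq.trans_le (le_trans ?_ hsmall))
    exact mul_le_mul_of_nonneg_left (by linarith [sq_nonneg ‖y‖]) (sq_nonneg _)
  have hy : ‖y‖ ≤ ε := by
    refine (sq_le_sq₀ (norm_nonneg _) hε.le).1 (h.norm_y_sq.trans_le (le_trans ?_ hsmall))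
    exact mul_le_mul_of_nonneg_left (by linarith [sq_nonneg ‖y‖]) (sq_nonneg _)
  have hu : η < ‖x ^ n * y ^ q‖ := by
    by_contra hle
    have := half_le_norm_of_norm_le (n := n) (u := x ^ n * y ^ q) (hηdef ▸ not_lt.1 hle)
    linarith
  have hx : X₀ < ‖x‖ := by
    by_contra hle
    push Not at hle
    have h1 : ‖x ^ n * y ^ q‖ ≤ X₀ ^ n * ε := by
      rw [norm_mul, norm_pow, norm_pow]
      refine mul_le_mul (pow_le_pow_left₀ (norm_nonneg _) hle n) ?_ (by positivity) (by positivity)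
      exact (pow_le_of_le_one (norm_nonneg _) (by linarith) (by omega)).trans hy
    linarith
  refine h.false_of_near_one hn hq hyz (fun h0 => ?_) ?_
  · rw [h0, norm_zero] at hx; linarith
  · have h1 := congrArg norm h.six_mul
    generalize x ^ n * y ^ q = u at h1 hu ⊢
    rw [show (6 * q * x * (u ^ 3 - u ^ 2) : ℂ) = (6 * q : ℝ) * (x * u ^ 2 * (u - 1)) by
        push_cast; ring, norm_mul, norm_mul μ, Complex.norm_real, Complex.norm_real,
      Real.norm_of_nonneg (by positivity), Real.norm_eq_abs,
      abs_of_nonpos (sub_nonpos.2 hyz), norm_mul, norm_mul, norm_pow] at h1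
    have h2 : ‖μ‖ * -(‖y‖ ^ 2 - ‖z‖ ^ 2) ≤ B :=
      (mul_le_mul_of_nonneg_left (by linarith [sq_nonneg ‖y‖]) (norm_nonneg μ)).trans hv2
    have h3 : ‖x‖ * ‖u‖ ^ 2 * ‖u - 1‖ ≤ B :=
      (le_mul_of_one_le_left (by positivity) (by linarith)).trans (h1.trans_le h2)
    have h5 : X₀ * η ^ 2 ≤ ‖x‖ * ‖u‖ ^ 2 :=
      mul_le_mul hx.le (pow_le_pow_left₀ hη.le hu.le 2) (by positivity) (norm_nonneg _)
    have h7 : X₀ * η ^ 2 * ‖u - 1‖ ≤ B :=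
      (mul_le_mul_of_nonneg_right h5 (norm_nonneg _)).trans h3
    by_contra hc
    have h8 := mul_lt_mul_of_pos_left (not_le.1 hc) (by positivity : 0 < X₀ * η ^ 2)
    linarith

end ScalarEstimates
end PolyInfinity

namespace PolyInfinity

section Examples

open MvPolynomial

/-- The polynomial `f_{n,q}` in the first three of `m` variables, plus the squares of the
remaining variables. -/
noncomputable def gPoly {m : ℕ} (hm : 3 ≤ m) (n q : ℕ) : MvPolynomial (Fin m) ℂ :=
  X ⟨0, by omega⟩
    - 3 * X ⟨0, by omega⟩ ^ (2 * n + 1) * X ⟨1, by omega⟩ ^ (2 * q)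
    + 2 * X ⟨0, by omega⟩ ^ (3 * n + 1) * X ⟨1, by omega⟩ ^ (3 * q)
    + X ⟨1, by omega⟩ * X ⟨2, by omega⟩
    + ∑ i : Fin m, if 3 ≤ i.val then X i ^ 2 else 0

theorem gPoly_three (n q : ℕ) : gPoly (le_refl 3) n q = fPoly n q := by
  simp only [gPoly, fPoly, Fin.sum_univ_three]
  simp

variable {m : ℕ} (hm : 3 ≤ m) (n q : ℕ) (x : Fin m → ℂ)

theorem eval_gPoly : eval x (gPoly hm n q) =
    x ⟨0, by omega⟩ * (1 - 3 * (x ⟨0, by omega⟩ ^ n * x ⟨1, by omega⟩ ^ q) ^ 2 +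
      2 * (x ⟨0, by omega⟩ ^ n * x ⟨1, by omega⟩ ^ q) ^ 3) + x ⟨1, by omega⟩ * x ⟨2, by omega⟩ +
      ∑ i : Fin m, if 3 ≤ i.val then x i ^ 2 else 0 := by
  simp only [gPoly, map_add, map_sub, map_mul, map_pow, eval_X, map_ofNat, map_sum, apply_ite (eval x),
    map_zero]
  ring

theorem pderiv_two (k : Fin m) : pderiv k (2 : MvPolynomial (Fin m) ℂ) = 0 :=
  Derivation.map_natCast _ 2

theorem pderiv_three (k : Fin m) : pderiv k (3 : MvPolynomial (Fin m) ℂ) = 0 :=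
  Derivation.map_natCast _ 3

theorem pderiv_sum_sq (k : Fin m) :
    pderiv k (∑ i : Fin m, if 3 ≤ i.val then (X i : MvPolynomial (Fin m) ℂ) ^ 2 else 0) =
      if 3 ≤ k.val then 2 * X k else 0 := by
  rw [map_sum, Finset.sum_eq_single k]
  · split_ifs <;> simp [Derivation.leibniz_pow]
  · intro j _ hj
    split_ifs <;> simp [Derivation.leibniz_pow, pderiv_X_of_ne hj]
  · simp

theorem eval_pderiv_gPoly_zero : eval x (pderiv ⟨0, by omega⟩ (gPoly hm n q)) =
    1 - 3 * (2 * n + 1) * (x ⟨0, by omega⟩ ^ n * x ⟨1, by omega⟩ ^ q) ^ 2 +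
      2 * (3 * n + 1) * (x ⟨0, by omega⟩ ^ n * x ⟨1, by omega⟩ ^ q) ^ 3 := by
  rw [gPoly, map_add, pderiv_sum_sq]
  simp [Derivation.leibniz, Derivation.leibniz_pow, pderiv_X, pderiv_two, pderiv_three, Fin.ext_iff]
  ring

theorem mul_eval_pderiv_gPoly_one (hq : 1 ≤ q) :
    x ⟨1, by omega⟩ * eval x (pderiv ⟨1, by omega⟩ (gPoly hm n q)) =
    6 * q * x ⟨0, by omega⟩ * ((x ⟨0, by omega⟩ ^ n * x ⟨1, by omega⟩ ^ q) ^ 3 -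
      (x ⟨0, by omega⟩ ^ n * x ⟨1, by omega⟩ ^ q) ^ 2) + x ⟨1, by omega⟩ * x ⟨2, by omega⟩ := by
  obtain ⟨r, rfl⟩ := Nat.exists_eq_add_of_le hq
  rw [gPoly, map_add, pderiv_sum_sq]
  simp [Derivation.leibniz, Derivation.leibniz_pow, pderiv_X, pderiv_two, pderiv_three, Fin.ext_iff,
    show 2 * (1 + r) - 1 = 2 * r + 1 by omega, show 3 * (1 + r) - 1 = 3 * r + 2 by omega]
  ring

theorem eval_pderiv_gPoly_two : eval x (pderiv ⟨2, by omega⟩ (gPoly hm n q)) =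
    x ⟨1, by omega⟩ := by
  rw [gPoly, map_add, pderiv_sum_sq]
  simp [Derivation.leibniz, Derivation.leibniz_pow, pderiv_X, pderiv_two, pderiv_three, Fin.ext_iff]

theorem eval_pderiv_gPoly_of_le {k : Fin m} (hk : 3 ≤ k.val) :
    eval x (pderiv k (gPoly hm n q)) = 2 * x k := by
  have h0 : ¬ 0 = k.val := by omega
  have h1 : ¬ 1 = k.val := by omega
  have h2 : ¬ 2 = k.val := by omega
  rw [gPoly, map_add, pderiv_sum_sq]
  simp [Derivation.leibniz, Derivation.leibniz_pow, pderiv_X, pderiv_two, pderiv_three, Fin.ext_iff, hk,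
    h0, h1, h2]

theorem sum_fin_eq {M : Type*} [AddCommMonoid M] (f : Fin m → M) :
    ∑ i, f i = f ⟨0, by omega⟩ + f ⟨1, by omega⟩ + f ⟨2, by omega⟩ +
      ∑ i : Fin m, if 3 ≤ i.val then f i else 0 := by
  obtain ⟨k, rfl⟩ := Nat.exists_eq_add_of_le hm
  rw [Fin.sum_univ_add, Fin.sum_univ_add (a := 3), Fin.sum_univ_three, Fin.sum_univ_three]
  simp
  rfl

theorem norm_sq_eq (X : EuclideanSpace ℂ (Fin m)) :
    ‖X‖ ^ 2 = ‖X ⟨0, by omega⟩‖ ^ 2 + ‖X ⟨1, by omega⟩‖ ^ 2 + ‖X ⟨2, by omega⟩‖ ^ 2 +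
      ∑ i : Fin m, if 3 ≤ i.val then ‖X i‖ ^ 2 else 0 := by
  rw [EuclideanSpace.norm_sq_eq, sum_fin_eq hm]

theorem milnorData_of_mem {X : EuclideanSpace ℂ (Fin m)} {B : ℝ} (hq : 1 ≤ q) {c : ℂ}
    (hX : grad (gPoly hm n q) X = c • X) (hB : ‖val (gPoly hm n q) X‖ ≤ B) :
    MilnorData n q B (X ⟨0, by omega⟩) (X ⟨1, by omega⟩) (X ⟨2, by omega⟩) ((starRingEnd ℂ) c)
      (∑ i : Fin m, if 3 ≤ i.val then X i ^ 2 else 0)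
      (∑ i : Fin m, if 3 ≤ i.val then ‖X i‖ ^ 2 else 0) := by
  have key (i : Fin m) : eval (fun j => X j) (pderiv i (gPoly hm n q)) =
      (starRingEnd ℂ) c * (starRingEnd ℂ) (X i) := by
    have h := congrArg (fun v : EuclideanSpace ℂ (Fin m) => (starRingEnd ℂ) (v i)) hX
    simpa [grad_apply] using h
  refine ⟨Finset.sum_nonneg fun i _ => by split_ifs <;> positivity, ?_, ?_, ?_, ?_, ?_⟩
  · rw [← key, eval_pderiv_gPoly_zero]
  · rw [← mul_eval_pderiv_gPoly_one hm n q (fun j => X j) hq, key]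
    push_cast
    rw [← Complex.mul_conj']; ring
  · rw [← key, eval_pderiv_gPoly_two]
  · push_cast
    rw [Finset.sum_div, Finset.mul_sum]
    refine Finset.sum_congr rfl fun i _ => ?_
    split_ifs with hi
    · have h := key i
      rw [eval_pderiv_gPoly_of_le hm n q _ hi] at h
      push_cast
      rw [← Complex.mul_conj']
      linear_combination X i / 2 * h
    · simp
  · rwa [← eval_gPoly]

theorem mTame_gPoly (hn : 1 ≤ n) (hq : 1 ≤ q) : MTame (gPoly hm n q) := by
  intro z hz hinf
  rw [tendsto_atTop]
  intro B
  obtain ⟨R, hR⟩ := exists_milnorData_bound hn hq (le_max_right B 0)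
  filter_upwards [hinf.eventually_gt_atTop (max R 1)] with k hk
  by_contra hcon
  obtain ⟨c, hc⟩ := hz k
  have h := hR _ _ _ _ _ _
    (milnorData_of_mem hm n q hq hc ((not_le.1 hcon).le.trans (le_max_left B 0)))
  rw [← norm_sq_eq hm] at h
  have h1 : ‖z k‖ ≤ ‖z k‖ ^ 2 := le_self_pow₀ ((le_max_right R 1).trans hk.le) two_ne_zero
  exact absurd (h1.trans h) (not_le.2 ((le_max_left R 1).trans_lt hk))

theorem malgrange_gPoly (hn : 1 ≤ n) (hq : n ≤ q) (t₀ : ℂ) : Malgrange (gPoly hm n q) t₀ := by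
  have hδ0 : (0 : ℝ) < 1 / (20 * (n + 1)) := by positivity
  have hδ1 : (1 : ℝ) / (20 * (n + 1)) ≤ 1 / 20 :=
    one_div_le_one_div_of_le (by norm_num) (by have := Nat.cast_nonneg (α := ℝ) n; linarith)
  refine ⟨1 / (20 * (n + 1)), hδ0, 1, 1, one_pos, fun X hX _ => ?_⟩
  by_contra hcon
  push Not at hcon
  have hle (i : Fin m) : ‖grad (gPoly hm n q) X i‖ ≤ ‖X‖ * ‖grad (gPoly hm n q) X‖ :=
    (PiLp.norm_apply_le _ i).trans (le_mul_of_one_le_left (norm_nonneg _) hX)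
  have h2 : ‖grad (gPoly hm n q) X ⟨2, by omega⟩‖ = ‖X ⟨1, by omega⟩‖ := by
    rw [grad_apply, RCLike.norm_conj, eval_pderiv_gPoly_two]
  have hy : ‖X ⟨1, by omega⟩‖ ≤ 1 := by
    have := hle ⟨2, by omega⟩
    rw [h2] at this
    linarith
  have hxy : ‖X ⟨0, by omega⟩‖ * ‖X ⟨1, by omega⟩‖ ≤ 1 / (20 * (n + 1)) := by
    rw [← h2]
    exact (mul_le_mul (PiLp.norm_apply_le X _) (PiLp.norm_apply_le _ _) (norm_nonneg _)
      (norm_nonneg _)).trans hcon.le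
  have h3 := half_le_norm_of_norm_le (norm_pow_mul_pow_le hn hq (by linarith) hxy hy)
  have h0 := hle ⟨0, by omega⟩
  rw [grad_apply, RCLike.norm_conj, eval_pderiv_gPoly_zero] at h0
  linarith

/-- Points along which `f_{n,q}` vanishes and its gradient tends to zero. -/
noncomputable def escapingPoint (m n q : ℕ) (t : ℂ) : EuclideanSpace ℂ (Fin m) :=
  WithLp.toLp 2 fun i => if i.val = 0 then t ^ q else if i.val = 1 then (t ^ n)⁻¹ else 0

theorem escapingPoint_of_le {k : Fin m} (hk : 3 ≤ k.val) (t : ℂ) :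
    escapingPoint m n q t k = 0 := by
  simp [escapingPoint, show k.val ≠ 0 by omega, show k.val ≠ 1 by omega]

theorem escapingPoint_pow_mul_pow {t : ℂ} (ht : t ≠ 0) :
    escapingPoint m n q t ⟨0, by omega⟩ ^ n * escapingPoint m n q t ⟨1, by omega⟩ ^ q = 1 := by
  have : t ^ (q * n) ≠ 0 := pow_ne_zero _ ht
  simp only [escapingPoint, one_ne_zero, if_true, if_false]
  rw [← pow_mul, inv_pow, ← pow_mul, mul_comm n q]
  exact mul_inv_cancel₀ this

theorem val_escapingPoint {t : ℂ} (ht : t ≠ 0) :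
    val (gPoly hm n q) (escapingPoint m n q t) = 0 := by
  rw [val, eval_gPoly, escapingPoint_pow_mul_pow hm n q ht, Finset.sum_eq_zero]
  · simp [escapingPoint]; norm_num
  · intro i _
    split_ifs with hi
    · rw [escapingPoint_of_le n q hi]; simp
    · rfl

theorem grad_escapingPoint (hq : 1 ≤ q) {t : ℂ} (ht : t ≠ 0) :
    grad (gPoly hm n q) (escapingPoint m n q t) =
      EuclideanSpace.single ⟨2, by omega⟩ ((starRingEnd ℂ) (t ^ n)⁻¹) := by
  have hu := escapingPoint_pow_mul_pow hm n q ht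
  ext i
  rw [grad_apply]
  rcases lt_or_ge i.val 3 with hi | hi
  · obtain ⟨i, him⟩ := i
    simp only at hi
    interval_cases i
    · rw [eval_pderiv_gPoly_zero, hu]
      rw [show (1 - 3 * (2 * n + 1) * 1 ^ 2 + 2 * (3 * n + 1) * 1 ^ 3 : ℂ) = 0 by ring]
      simp
    · have h := mul_eval_pderiv_gPoly_one hm n q (fun j => escapingPoint m n q t j) hq
      rw [hu] at h
      simp [escapingPoint, ht] at h ⊢
      exact h
    · rw [eval_pderiv_gPoly_two]
      simp [escapingPoint]
  · rw [eval_pderiv_gPoly_of_le hm n q _ hi, escapingPoint_of_le n q hi]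
    simp [show i ≠ ⟨2, by omega⟩ from fun h => by simp [h] at hi]

theorem norm_grad_escapingPoint (hq : 1 ≤ q) {t : ℂ} (ht : t ≠ 0) :
    ‖grad (gPoly hm n q) (escapingPoint m n q t)‖ = (‖t‖ ^ n)⁻¹ := by
  rw [grad_escapingPoint hm n q hq ht, PiLp.norm_single, RCLike.norm_conj, norm_inv,
    norm_pow]

theorem inner_grad_escapingPoint (hq : 1 ≤ q) {t : ℂ} (ht : t ≠ 0) :
    inner ℂ (grad (gPoly hm n q) (escapingPoint m n q t)) (escapingPoint m n q t) = 0 := by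
  rw [grad_escapingPoint hm n q hq ht, EuclideanSpace.inner_single_left]
  simp [escapingPoint]

theorem le_norm_escapingPoint (hm : 3 ≤ m) (t : ℂ) : ‖t‖ ^ q ≤ ‖escapingPoint m n q t‖ := by
  have h := PiLp.norm_apply_le (escapingPoint m n q t) ⟨0, by omega⟩
  simpa [escapingPoint] using h

theorem norm_escapingPoint_le (hm : 3 ≤ m) {t : ℂ} (ht : 1 ≤ ‖t‖) :
    ‖escapingPoint m n q t‖ ≤ 2 * ‖t‖ ^ q := by
  refine (sq_le_sq₀ (norm_nonneg _) (by positivity)).1 ?_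
  have hx : 1 ≤ ‖t‖ ^ q := one_le_pow₀ ht
  have hy : (‖t‖ ^ n)⁻¹ ≤ 1 := inv_le_one_of_one_le₀ (one_le_pow₀ ht)
  have hy2 : (‖t‖ ^ n)⁻¹ ^ 2 ≤ 1 := pow_le_one₀ (by positivity) hy
  have hx2 : 1 ≤ (‖t‖ ^ q) ^ 2 := one_le_pow₀ hx
  rw [norm_sq_eq hm, Finset.sum_eq_zero]
  · simp only [escapingPoint, if_true, one_ne_zero, if_false, norm_pow, norm_inv, norm_zero,
      OfNat.ofNat_ne_zero, OfNat.ofNat_ne_one]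
    linarith
  · intro i _
    split_ifs with hi
    · rw [escapingPoint_of_le n q hi]; simp
    · rfl

theorem norm_natCast_succ (k : ℕ) : ‖((k + 1 : ℕ) : ℂ)‖ = (k : ℝ) + 1 := by
  rw [Complex.norm_natCast]; push_cast; ring

theorem tendsto_norm_escapingPoint (hm : 3 ≤ m) (hq : 1 ≤ q) :
    Tendsto (fun k : ℕ => ‖escapingPoint m n q ((k + 1 : ℕ) : ℂ)‖) atTop atTop := by
  refine tendsto_atTop_mono (fun k => ?_)
    (tendsto_atTop_add_const_right _ 1 (tendsto_natCast_atTop_atTop (R := ℝ)))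
  refine le_trans ?_ (le_norm_escapingPoint n q hm _)
  rw [norm_natCast_succ]
  exact le_self_pow₀ (by have := Nat.cast_nonneg (α := ℝ) k; linarith) (by omega)

theorem not_quasitame_gPoly (hn : 1 ≤ n) (hq : 1 ≤ q) : ¬ Quasitame (gPoly hm n q) := by
  intro h
  have ht (k : ℕ) : ((k + 1 : ℕ) : ℂ) ≠ 0 := Nat.cast_ne_zero.2 k.succ_ne_zero
  have h1 := h _ (tendsto_norm_escapingPoint n q hm hq) (by
    rw [tendsto_zero_iff_norm_tendsto_zero]
    simp only [norm_grad_escapingPoint hm n q hq (ht _), norm_natCast_succ]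
    refine squeeze_zero (fun k => by positivity) (fun k => ?_)
      (tendsto_one_div_add_atTop_nhds_zero_nat (𝕜 := ℝ))
    rw [one_div]
    refine inv_anti₀ (by positivity) (le_self_pow₀ ?_ (by omega))
    have := Nat.cast_nonneg (α := ℝ) k; linarith)
  simp only [val_escapingPoint hm n q (ht _), inner_grad_escapingPoint hm n q hq (ht _), sub_zero,
    norm_zero] at h1
  exact not_tendsto_const_atTop _ _ h1

theorem not_malgrange_gPoly (hq : 1 ≤ q) (hqn : q < n) : ¬ Malgrange (gPoly hm n q) 0 := by
  rintro ⟨δ, hδ, R, ε, hε, h⟩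
  have h1 : Tendsto (fun k : ℕ => 2 * (1 / ((k : ℝ) + 1))) atTop (𝓝 (2 * 0)) :=
    (tendsto_one_div_add_atTop_nhds_zero_nat (𝕜 := ℝ)).const_mul 2
  rw [mul_zero] at h1
  obtain ⟨k, hk, hkδ⟩ := (((tendsto_norm_escapingPoint n q hm hq).eventually_ge_atTop R).and
    (h1.eventually_lt_const hδ)).exists
  have ht : ((k + 1 : ℕ) : ℂ) ≠ 0 := Nat.cast_ne_zero.2 k.succ_ne_zero
  have h2 := h _ hk (by rw [val_escapingPoint hm n q ht]; simpa using hε)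
  have h3 : (1 : ℝ) ≤ k + 1 := by have := Nat.cast_nonneg (α := ℝ) k; linarith
  have h4 := norm_escapingPoint_le n q hm (t := ((k + 1 : ℕ) : ℂ)) (by rwa [norm_natCast_succ])
  rw [norm_grad_escapingPoint hm n q hq ht, norm_natCast_succ] at h2
  rw [norm_natCast_succ] at h4
  have h5 := mul_le_mul_of_nonneg_right h4 (by positivity : (0 : ℝ) ≤ (((k : ℝ) + 1) ^ n)⁻¹)
  have h6 : ((k : ℝ) + 1) ^ (q + 1) ≤ (k + 1) ^ n := pow_le_pow_right₀ h3 hqn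
  have h7 : ((k : ℝ) + 1) ^ q * ((k + 1 : ℝ) ^ n)⁻¹ ≤ 1 / (k + 1) := by
    rw [← div_eq_mul_inv, div_le_div_iff₀ (by positivity) (by positivity), one_mul, ← pow_succ]
    exact h6
  linarith

end Examples
end PolyInfinity

theorem proposition1p8 :
    (∀ n q : ℕ, 1 ≤ n → 1 ≤ q →
      PolyInfinity.MTame (PolyInfinity.fPoly n q) ∧
      ¬ PolyInfinity.Quasitame (PolyInfinity.fPoly n q)) ∧
    (∀ n q : ℕ, 1 ≤ n → 1 ≤ q →
      ((∀ t₀ : ℂ, PolyInfinity.Malgrange (PolyInfinity.fPoly n q) t₀) ↔ n ≤ q)) ∧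
    (∀ m : ℕ, 3 ≤ m →
      (∀ g : MvPolynomial (Fin m) ℂ,
        PolyInfinity.Quasitame g → ∀ t₀ : ℂ, PolyInfinity.Malgrange g t₀) ∧
      (∃ g : MvPolynomial (Fin m) ℂ,
        (∀ t₀ : ℂ, PolyInfinity.Malgrange g t₀) ∧ ¬ PolyInfinity.Quasitame g) ∧
      (∀ g : MvPolynomial (Fin m) ℂ,
        (∀ t₀ : ℂ, PolyInfinity.Malgrange g t₀) → PolyInfinity.MTame g) ∧
      (∃ g : MvPolynomial (Fin m) ℂ,
        PolyInfinity.MTame g ∧ ¬ ∀ t₀ : ℂ, PolyInfinity.Malgrange g t₀)) := by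
  refine ⟨fun n q hn hq => ?_, fun n q hn hq => ⟨fun h => ?_, fun h => ?_⟩, fun m hm =>
    ⟨fun g hg => PolyInfinity.malgrange_of_quasitame g hg,
      ⟨PolyInfinity.gPoly hm 1 1, PolyInfinity.malgrange_gPoly hm 1 1 le_rfl le_rfl,
        PolyInfinity.not_quasitame_gPoly hm 1 1 le_rfl le_rfl⟩,
      fun g hg => PolyInfinity.mTame_of_malgrange g hg,
      ⟨PolyInfinity.gPoly hm 2 1, PolyInfinity.mTame_gPoly hm 2 1 one_le_two le_rfl,
        fun h => PolyInfinity.not_malgrange_gPoly hm 2 1 le_rfl one_lt_two (h 0)⟩⟩⟩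
  · rw [← PolyInfinity.gPoly_three]
    exact ⟨PolyInfinity.mTame_gPoly _ n q hn hq, PolyInfinity.not_quasitame_gPoly _ n q hn hq⟩
  · by_contra hcon
    rw [← PolyInfinity.gPoly_three] at h
    exact PolyInfinity.not_malgrange_gPoly _ n q hq (not_le.1 hcon) (h 0)
  · rw [← PolyInfinity.gPoly_three]
    exact PolyInfinity.malgrange_gPoly _ n q hn h
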